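/- Setting. For $k=1,2,\ldots$ let $X=X_k$ be a deterministic real $n_k\times p_k$ matrix with $p=p_k\to\infty$ (the $n_k$ are arbitrary), and let $Y=X\beta^0+\varepsilon$ with $\varepsilon$ an $n_k$-variate standard normal vector; $\mathbb E_{\beta^0}$ is the expectation under the law of $Y$. Let $S_\beta=\{i:\beta_i\ne0\}$, $S_0=S_{\beta^0}$, $\|X\|=\max_{i}\|X_{\cdot,i}\|_2$ (the maximal column length) and $\overline\lambda=2\|X\|\sqrt{\log p}$. The prior $\Pi$ on $\beta\in\mathbb R^p$ draws a dimension $s$ from a probability distribution $\pi_p$ on $\{0,\ldots,p\}$, then $S$ uniformly from the subsets of $\{1,\ldots,p\}$ of cardinality $s$, and then, independently, the coordinates $\beta_i$, $i\in S$, from the Laplace density $x\mapsto\frac{\lambda}{2}e^{-\lambda|x|}$, where $\lambda=\lambda_k>0$, with $\beta_i=0$ for $i\notin S$. The posterior distribution is $\Pi(B\mid Y)=\int_B e^{-\|Y-X\beta\|_2^2/2}\,d\Pi(\beta)\big/\int e^{-\|Y-X\beta\|_2^2/2}\,d\Pi(\beta)$. For $S\subset\{1,\ldots,p\}$ and $s\ge0$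 put (with infima in $[0,\infty]$ and $\inf\emptyset=\infty$) $$\phi(S)=\inf\Big\{\frac{\|X\beta\|_2|S|^{1/2}}{\|X\|\,\|\beta_S\|_1}:\ \|\beta_{S^c}\|_1\le7\|\beta_S\|_1,\ \beta_S\ne0\Big\},\qquad \widetilde\phi(s)=\inf\Big\{\frac{\|X\beta\|_2}{\|X\|\,\|\beta\|_2}:\ 0\ne|S_\beta|\le s\Big\},$$ $$\widetilde\psi(S)=\widetilde\phi\Big(\Big(2+\frac3{A_4}+\frac{33}{\phi(S)^2}\frac{\lambda}{\overline\lambda}\Big)|S|\Big).$$ Theorem (Selection: no supersets). Suppose that $\|X\|/p\le\lambda\le2\overline\lambda$ and that there are constants $A_1,A_2,A_3>0$ and $A_4>1$, not depending on $k$, with $$A_1p^{-A_3}\pi_p(s-1)\le\pi_p(s)\le A_2p^{-A_4}\pi_p(s-1),\qquad s=1,\ldots,p.$$ Then for every $c_0>0$, every $a<A_4-1$ and every sequence $s_k\le p^a$ with $s_k\lambda\sqrt{\log p}/\|X\|\to0$, $$\sup_{\beta^0:\ \phi(S_0)\ge c_0,\ |S_0|\le s_k,\ \widetilde\psi(S_0)\ge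 c_0}\ \mathbb E_{\beta^0}\Pi\big(\beta:\ S_\beta\supset S_0,\ S_\beta\ne S_0\,\big|\,Y\big)\to0\qquad(k\to\infty).$$ -/

import Mathlib

open MeasureTheory ProbabilityTheory Filter Topology
open scoped ENNReal Matrix

noncomputable section

namespace SparseRegression

/-- The support `S_β = {i : β_i ≠ 0}` of a vector. -/
def support {p : ℕ} (β : Fin p → ℝ) : Finset (Fin p) :=
  Finset.univ.filter fun i => β i ≠ 0

/-- The Euclidean norm of a vector. -/
def l2norm {ι : Type*} [Fintype ι] (v : ι → ℝ) : ℝ := √(∑ i, v i ^ 2)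

/-- `‖β_S‖₁`, the ℓ¹-norm of the coordinates of `β` in `S`. -/
def l1normOn {p : ℕ} (S : Finset (Fin p)) (β : Fin p → ℝ) : ℝ := ∑ i ∈ S, |β i|

/-- `‖X‖`, the maximal Euclidean length of a column of `X`. -/
def colNorm {n p : ℕ} (X : Matrix (Fin n) (Fin p) ℝ) : ℝ :=
  ⨆ j, l2norm fun i => X i j

/-- `2 ‖X‖ √(log p)`. -/
def lamBar {n p : ℕ} (X : Matrix (Fin n) (Fin p) ℝ) : ℝ :=
  2 * colNorm X * √(Real.log p)

/-- The law of the data `Y = X β + ε`, with `ε` an `n`-variate standard normal vector. -/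
def dataLaw {n p : ℕ} (X : Matrix (Fin n) (Fin p) ℝ) (β : Fin p → ℝ) :
    Measure (Fin n → ℝ) :=
  Measure.pi fun i => gaussianReal ((X *ᵥ β) i) 1

/-- The Laplace distribution on `ℝ`, with density `x ↦ (lam / 2) exp (-lam |x|)`. -/
def laplace (lam : ℝ) : Measure ℝ :=
  volume.withDensity fun x => ENNReal.ofReal (lam / 2 * Real.exp (-lam * |x|))

open Classical in
/-- Given the model `S`, the coordinates of `β` are independent, Laplace distributed if they
belong to `S`, and zero otherwise. -/
def modelPrior {p : ℕ} (lam : ℝ) (S : Finset (Fin p)) : Measure (Fin p → ℝ) :=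
  Measure.pi fun i => if i ∈ S then laplace lam else Measure.dirac 0

/-- The prior on `β`: a dimension `s` is drawn from `w`, then a set `S` uniformly among the sets
of cardinality `s`, and then `β` from the prior of the model `S`. -/
def prior (p : ℕ) (w : ℕ → ℝ) (lam : ℝ) : Measure (Fin p → ℝ) :=
  ∑ S : Finset (Fin p), ENNReal.ofReal (w S.card / (p.choose S.card)) • modelPrior lam S

/-- The Gaussian likelihood, up to a factor that does not depend on `β`. -/
def likelihood {n p : ℕ} (X : Matrix (Fin n) (Fin p) ℝ) (y : Fin n → ℝ) (β : Fin p → ℝ) :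
    ℝ≥0∞ :=
  ENNReal.ofReal (Real.exp (-(l2norm (y - X *ᵥ β)) ^ 2 / 2))

/-- The posterior probability of `B` given the data `y`, by Bayes's formula. -/
def posterior {n p : ℕ} (X : Matrix (Fin n) (Fin p) ℝ) (w : ℕ → ℝ) (lam : ℝ)
    (y : Fin n → ℝ) (B : Set (Fin p → ℝ)) : ℝ≥0∞ :=
  (∫⁻ β in B, likelihood X y β ∂(prior p w lam)) / ∫⁻ β, likelihood X y β ∂(prior p w lam)

/-- `w` restricted to `{0, …, p}` is a probability mass function. -/
def IsDimensionPMF (p : ℕ) (w : ℕ → ℝ) : Prop :=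
  (∀ s ≤ p, 0 ≤ w s) ∧ ∑ s ∈ Finset.range (p + 1), w s = 1

/-- The exponential decrease condition on the prior of the dimension. -/
def DimensionDecrease (A₁ A₂ A₃ A₄ : ℝ) (p : ℕ) (w : ℕ → ℝ) : Prop :=
  ∀ s : ℕ, 1 ≤ s → s ≤ p →
    A₁ * (p : ℝ) ^ (-A₃) * w (s - 1) ≤ w s ∧ w s ≤ A₂ * (p : ℝ) ^ (-A₄) * w (s - 1)

/-- The compatibility number `φ(S)`. It has values in `[0, ∞]`; the infimum over the empty set,
which arises for empty `S`, is `∞`. -/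
def compat {n p : ℕ} (X : Matrix (Fin n) (Fin p) ℝ) (S : Finset (Fin p)) : ℝ≥0∞ :=
  ⨅ (β : Fin p → ℝ) (_ : l1normOn Sᶜ β ≤ 7 * l1normOn S β) (_ : ∃ i ∈ S, β i ≠ 0),
    ENNReal.ofReal (l2norm (X *ᵥ β) * √(S.card : ℝ) / (colNorm X * l1normOn S β))

/-- The smallest scaled sparse singular value of dimension `s ∈ [0, ∞]`, with values in
`[0, ∞]`; the infimum over the empty set is `∞`. -/
def smallestSV {n p : ℕ} (X : Matrix (Fin n) (Fin p) ℝ) (s : ℝ≥0∞) : ℝ≥0∞ :=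
  ⨅ (β : Fin p → ℝ) (_ : β ≠ 0) (_ : ((support β).card : ℝ≥0∞) ≤ s),
    ENNReal.ofReal (l2norm (X *ᵥ β) / (colNorm X * l2norm β))

/-- The smallest scaled sparse singular value of dimension
`(2 + 3 / A₄ + (33 / φ(S)²) (lam / lamBar)) |S|`. -/
def psiTilde {n p : ℕ} (X : Matrix (Fin n) (Fin p) ℝ) (lam A₄ : ℝ) (S : Finset (Fin p)) :
    ℝ≥0∞ :=
  smallestSV X
    ((ENNReal.ofReal (2 + 3 / A₄) + 33 / compat X S ^ 2 * ENNReal.ofReal (lam / lamBar X))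
      * S.card)

end SparseRegression

end

noncomputable section

namespace SparseRegression

/-! Strict supersets of the true model `S₀` are the sets `S₀ ∪ T` with `T` nonempty and disjoint
from `S₀`, and the posterior mass of all of them is at most the sum of their posterior odds against
`S₀`. No posterior contraction theorem is needed: the odds are bounded directly, by two methods
according to the size of `T`. Write s for |S₀|, J for |T| and x for (λ/λ̄)/φ(S₀)².

Large T, J > (1 + 3/A₄ + 33x)s: a first moment on the event that the noise has inner product at most
λ̄ with every column. There the evidence of `S₀` is bounded below by integrating over a small box
around β⁰ (`le_evidence`), and compatibility bounds the expected evidence of the superset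
(`setLIntegral_evidence_le`). The cost is p^(2s + 49xs/4) up to factors (C √log p)^J. The threshold
makes it at most p^(2A₄J/3), which the factor p^(-A₄J) from the dimension prior beats.

Small T: the sparse singular value bound is available on `S₀ ∪ T`. Projecting out the columns of
`S₀` factorizes the likelihood, so that the evidence ratio is at most a Gaussian mixture depending
only on the noise in a space of dimension at most J (`evidence_union_le`). This mixture can have
infinite mean, but its square root has mean at most C(C' √log p)^(J/2)
(`lintegral_sqrt_mixture_le`). Since min(1, Σ odds) ≤ Σ √odds, half moments suffice. There are at
most p^J sets T of size J, and s + J is at most a constant times p^a, so the sum over them is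
governed by p^((1 - A₄ + a)J/2), up to factors (C log p)^(J/4); this is where a < A₄ - 1 enters.

Both bounds are geometric in J, with ratios `rateLarge` and `rateSmall` that tend to 0 and do not
depend on β⁰. -/

/-! ### Product measures, Lebesgue measure on coordinate subspaces, Laplace priors -/

/-- Tonelli's theorem for a product of functions of the separate coordinates. -/
theorem lintegral_pi_prod : ∀ {n : ℕ} (μ : Fin n → Measure ℝ) [∀ i, SigmaFinite (μ i)]
    (f : Fin n → ℝ → ℝ≥0∞), (∀ i, Measurable (f i)) →
    ∫⁻ x, ∏ i, f i (x i) ∂(Measure.pi μ) = ∏ i, ∫⁻ t, f i t ∂(μ i)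
  | 0, μ, _, f, _ => by simp
  | n + 1, μ, _, f, hf => by
    rw [← ((measurePreserving_piFinSuccAbove μ 0).symm).lintegral_comp_emb
      (MeasurableEquiv.measurableEmbedding _)]
    simp_rw [MeasurableEquiv.piFinSuccAbove_symm_apply, Fin.insertNthEquiv,
      Fin.prod_univ_succ, Equiv.coe_fn_mk, Fin.insertNth_zero, Fin.cons_succ,
      Fin.zero_succAbove, Fin.cons_zero, cast_eq]
    rw [lintegral_prod_mul (f := f 0) (g := fun y : Fin n → ℝ => ∏ i, f i.succ (y i))
      (hf 0).aemeasurable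
      (Finset.measurable_prod _ fun i _ => (hf _).comp (measurable_pi_apply i)).aemeasurable]
    congr 1
    exact lintegral_pi_prod (fun i => μ i.succ) (fun i => f i.succ) fun i => hf _

theorem pi_withDensity {n : ℕ} (μ : Fin n → Measure ℝ) [∀ i, SigmaFinite (μ i)]
    (f : Fin n → ℝ → ℝ≥0∞) (hf : ∀ i, Measurable (f i))
    [∀ i, SigmaFinite ((μ i).withDensity (f i))] :
    Measure.pi (fun i => (μ i).withDensity (f i)) =
      (Measure.pi μ).withDensity fun x => ∏ i, f i (x i) := by
  refine Measure.pi_eq fun s hs => ?_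
  rw [withDensity_apply _ (MeasurableSet.univ_pi hs), ← lintegral_indicator
    (MeasurableSet.univ_pi hs)]
  have : ∀ x : Fin n → ℝ, (Set.univ.pi s).indicator (fun x => ∏ i, f i (x i)) x =
      ∏ i, (s i).indicator (f i) (x i) := by
    intro x
    by_cases hx : x ∈ Set.univ.pi s
    · rw [Set.indicator_of_mem hx]
      exact Finset.prod_congr rfl fun i _ => (Set.indicator_of_mem (hx i (Set.mem_univ i)) _).symm
    · rw [Set.indicator_of_notMem hx]
      simp only [Set.mem_pi, Set.mem_univ, true_implies, not_forall] at hx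
      obtain ⟨i, hi⟩ := hx
      exact (Finset.prod_eq_zero (Finset.mem_univ i) (Set.indicator_of_notMem hi _)).symm
  simp_rw [this]
  rw [lintegral_pi_prod _ _ fun i => (hf i).indicator (hs i)]
  exact Finset.prod_congr rfl fun i _ => by
    rw [lintegral_indicator (hs i), withDensity_apply _ (hs i)]

open Classical in
/-- Lebesgue measure on the coordinate subspace `{u : u_i = 0 for i ∉ S}`, seen as a measure on
the whole space. -/
def coordVolume {p : ℕ} (S : Finset (Fin p)) : Measure (Fin p → ℝ) :=
  Measure.pi fun i => if i ∈ S then volume else Measure.dirac 0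

instance sigmaFinite_coord {p : ℕ} (S : Finset (Fin p)) (i : Fin p) [Decidable (i ∈ S)] :
    SigmaFinite (if i ∈ S then (volume : Measure ℝ) else Measure.dirac 0) := by
  split_ifs <;> infer_instance

instance {p : ℕ} (S : Finset (Fin p)) : SigmaFinite (coordVolume S) := by
  unfold coordVolume; infer_instance

theorem ae_coordVolume {p : ℕ} (S : Finset (Fin p)) :
    ∀ᵐ u ∂(coordVolume S), ∀ i ∉ S, u i = 0 := by
  rw [ae_all_iff]
  intro i
  by_cases hi : i ∈ S
  · simp [hi]
  simp only [hi, not_false_eq_true, forall_const]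
  refine (Measure.tendsto_eval_ae_ae (i := i)).eventually (p := fun t : ℝ => t = 0) ?_
  simp [hi, ae_dirac_eq]

theorem lintegral_coordVolume_add_right {p : ℕ} (S : Finset (Fin p)) (z : Fin p → ℝ)
    (hz : ∀ i ∉ S, z i = 0) (f : (Fin p → ℝ) → ℝ≥0∞) (hf : Measurable f) :
    ∫⁻ u, f (u + z) ∂(coordVolume S) = ∫⁻ u, f u ∂(coordVolume S) := by
  classical
  have h1 : ∀ i, (if i ∈ S then (volume : Measure ℝ) else Measure.dirac 0).map (fun t => t + z i)
      = if i ∈ S then volume else Measure.dirac 0 := by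
    intro i
    by_cases hi : i ∈ S
    · simp only [hi, if_true]; exact map_add_right_eq_self volume (z i)
    · simp only [hi, if_false, hz i hi, add_zero]; exact Measure.map_id
  have h2 : (coordVolume S).map (fun u => u + z) = coordVolume S := by
    have : ∀ i, SigmaFinite ((if i ∈ S then (volume : Measure ℝ) else Measure.dirac 0).map
        (fun t => t + z i)) := fun i => by rw [h1 i]; infer_instance
    have := Measure.pi_map_pi (μ := fun i => if i ∈ S then (volume : Measure ℝ)
      else Measure.dirac 0) (f := fun i t => t + z i) (fun i => by fun_prop)
    simp only [h1] at this
    unfold coordVolume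
    convert this using 2
    rfl
  conv_rhs => rw [← h2, lintegral_map hf (by fun_prop)]

theorem lintegral_coordVolume_union {p : ℕ} (S T : Finset (Fin p)) (hST : Disjoint S T)
    (f : (Fin p → ℝ) → ℝ≥0∞) (hf : Measurable f) :
    ∫⁻ u, f u ∂(coordVolume (S ∪ T)) =
      ∫⁻ v, ∫⁻ u, f (u + v) ∂(coordVolume S) ∂(coordVolume T) := by
  classical
  -- Almost everywhere `g (v, u) = u + v`. Selecting coordinates instead of adding makes the
  -- preimage of a box a product of boxes; the coordinates left free carry Dirac masses, hence mass
  -- 1.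
  let g : (Fin p → ℝ) × (Fin p → ℝ) → Fin p → ℝ := fun x i => if i ∈ S then x.2 i else x.1 i
  have hg : Measurable g := by
    refine measurable_pi_lambda _ fun i => ?_
    by_cases hi : i ∈ S <;> simp only [g, hi, if_true, if_false] <;> fun_prop
  have hmap : ((coordVolume T).prod (coordVolume S)).map g = coordVolume (S ∪ T) := by
    unfold coordVolume
    refine (Measure.pi_eq fun s hs => ?_).symm
    rw [Measure.map_apply hg (MeasurableSet.univ_pi hs)]
    have : g ⁻¹' Set.univ.pi s = (Set.univ.pi fun i => if i ∈ S then Set.univ else s i) ×ˢ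
        (Set.univ.pi fun i => if i ∈ S then s i else Set.univ) := by
      ext x
      simp only [g, Set.mem_preimage, Set.mem_pi, Set.mem_univ, true_implies, Set.mem_prod,
        ← forall_and]
      refine forall_congr' fun i => ?_
      by_cases hi : i ∈ S <;> simp [hi]
    rw [this, Measure.prod_prod, Measure.pi_pi, Measure.pi_pi, ← Finset.prod_mul_distrib]
    refine Finset.prod_congr rfl fun i _ => ?_
    by_cases hi : i ∈ S
    · have : i ∉ T := Finset.disjoint_left.1 hST hi
      simp [hi, this]
    · simp [hi]
  rw [← hmap, lintegral_map hf hg, lintegral_prod (fun a => f (g a)) (hf.comp hg).aemeasurable]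
  refine lintegral_congr_ae ?_
  filter_upwards [ae_coordVolume T] with v hv
  refine lintegral_congr_ae ?_
  filter_upwards [ae_coordVolume S] with u hu
  congr 1
  ext i
  by_cases hi : i ∈ S
  · simp [g, hi, hv i (Finset.disjoint_left.1 hST hi)]
  · simp [g, hi, hu i hi]

theorem lintegral_coordVolume_prod {p : ℕ} (S : Finset (Fin p)) (f : Fin p → ℝ → ℝ≥0∞)
    (hf : ∀ i, Measurable (f i)) :
    ∫⁻ u, ∏ i, f i (u i) ∂(coordVolume S) =
      (∏ i ∈ S, ∫⁻ t, f i t) * ∏ i ∈ Sᶜ, f i 0 := by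
  classical
  unfold coordVolume
  rw [lintegral_pi_prod _ _ hf, ← Finset.prod_mul_prod_compl S]
  congr 1
  · exact Finset.prod_congr rfl fun i hi => by simp [hi]
  · exact Finset.prod_congr rfl fun i hi => by
      simp [Finset.mem_compl.1 hi, lintegral_dirac' _ (hf i)]

theorem modelPrior_eq_withDensity {p : ℕ} {lam : ℝ} (hlam : 0 < lam) (S : Finset (Fin p)) :
    modelPrior lam S = (coordVolume S).withDensity fun u =>
      ENNReal.ofReal ((lam / 2) ^ S.card * Real.exp (-lam * l1normOn S u)) := by
  classical
  have hone : ∀ i : Fin p, Measurable (if i ∈ S then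
      fun x : ℝ => ENNReal.ofReal (lam / 2 * Real.exp (-lam * |x|)) else fun _ => 1) := by
    intro i; split_ifs <;> fun_prop
  have heq : ∀ i : Fin p, (if i ∈ S then laplace lam else Measure.dirac 0) =
      (if i ∈ S then (volume : Measure ℝ) else Measure.dirac 0).withDensity
        (if i ∈ S then
          fun x : ℝ => ENNReal.ofReal (lam / 2 * Real.exp (-lam * |x|)) else fun _ => 1) := by
    intro i
    by_cases hi : i ∈ S
    · simp [hi, laplace]
    · simp only [hi, if_false]; exact withDensity_one.symm
  have hsf : ∀ i : Fin p, SigmaFinite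
      ((if i ∈ S then (volume : Measure ℝ) else Measure.dirac 0).withDensity
        (if i ∈ S then
          fun x : ℝ => ENNReal.ofReal (lam / 2 * Real.exp (-lam * |x|)) else fun _ => 1)) := by
    intro i
    refine SigmaFinite.withDensity_of_ne_top (Eventually.of_forall fun x => ?_)
    split_ifs <;> simp
  unfold modelPrior coordVolume
  have := pi_withDensity (fun i => if i ∈ S then (volume : Measure ℝ) else Measure.dirac 0) _ hone
  simp only [← heq] at this
  convert this using 2 with i
  ext u
  rw [← Finset.prod_mul_prod_compl S]
  have h2 : ∏ i ∈ Sᶜ, (if i ∈ S then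
      fun x : ℝ => ENNReal.ofReal (lam / 2 * Real.exp (-lam * |x|)) else fun _ => 1) (u i) = 1 :=
    Finset.prod_eq_one fun i hi => by simp [Finset.mem_compl.1 hi]
  have h3 : ∏ i ∈ S, (if i ∈ S then
      fun x : ℝ => ENNReal.ofReal (lam / 2 * Real.exp (-lam * |x|)) else fun _ => 1) (u i) =
      ∏ i ∈ S, ENNReal.ofReal (lam / 2 * Real.exp (-lam * |u i|)) :=
    Finset.prod_congr rfl fun i hi => by simp [hi]
  rw [h2, h3, mul_one, ← ENNReal.ofReal_prod_of_nonneg fun i _ => by positivity]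
  rw [Finset.prod_mul_distrib, Finset.prod_const, ← Real.exp_sum, ← Finset.mul_sum, l1normOn]

theorem measurable_l1normOn {p : ℕ} (S : Finset (Fin p)) : Measurable (l1normOn S) := by
  unfold l1normOn; fun_prop

theorem lintegral_modelPrior {p : ℕ} {lam : ℝ} (hlam : 0 < lam) (S : Finset (Fin p))
    (f : (Fin p → ℝ) → ℝ≥0∞) (hf : Measurable f) :
    ∫⁻ u, f u ∂(modelPrior lam S) = ∫⁻ u,
      ENNReal.ofReal ((lam / 2) ^ S.card * Real.exp (-lam * l1normOn S u)) * f u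
        ∂(coordVolume S) := by
  have := measurable_l1normOn S
  rw [modelPrior_eq_withDensity hlam, lintegral_withDensity_eq_lintegral_mul _ (by fun_prop) hf]
  rfl

theorem ae_modelPrior {p : ℕ} {lam : ℝ} (hlam : 0 < lam) (S : Finset (Fin p)) :
    ∀ᵐ u ∂(modelPrior lam S), ∀ i ∉ S, u i = 0 := by
  rw [modelPrior_eq_withDensity hlam]
  exact (withDensity_absolutelyContinuous _ _).ae_le (ae_coordVolume S)

/-! ### Exponential moments of Gaussian vectors -/

theorem lintegral_exp_mul_sub_gaussianReal (c m : ℝ) :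
    ∫⁻ t, ENNReal.ofReal (Real.exp (c * (t - m))) ∂(gaussianReal m 1) =
      ENNReal.ofReal (Real.exp (c ^ 2 / 2)) := by
  have h1 : ∀ t, Real.exp (c * (t - m)) = Real.exp (-(c * m)) * Real.exp (c * t) := by
    intro t; rw [← Real.exp_add]; ring_nf
  have hint := (integrable_exp_mul_gaussianReal (μ := m) (v := 1) c).const_mul (Real.exp (-(c * m)))
  have hmgf := mgf_gaussianReal (p := gaussianReal m 1) (X := id) (μ := m) (v := 1)
    (by simp) c
  simp only [mgf, id] at hmgf
  simp_rw [h1]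
  rw [← ofReal_integral_eq_lintegral_ofReal hint (Eventually.of_forall fun t => by positivity),
    integral_const_mul, hmgf, ← Real.exp_add]
  congr 2
  simp
  ring

/-- The chi-square moment (1 - 2·3/8)^(-1/2) = 2. The exponent 3/8 is half of the 3/4 that appears
in the mixture bound for nested models; 3/4 itself exceeds the critical value 1/2. -/
theorem lintegral_exp_sq_gaussianReal :
    ∫⁻ t, ENNReal.ofReal (Real.exp (3 / 8 * t ^ 2)) ∂(gaussianReal 0 1) = 2 := by
  rw [gaussianReal_of_var_ne_zero 0 one_ne_zero,
    lintegral_withDensity_eq_lintegral_mul _ (measurable_gaussianPDF 0 1) (by fun_prop)]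
  have h : ∀ t : ℝ, (gaussianPDF 0 1 * fun t => ENNReal.ofReal (Real.exp (3 / 8 * t ^ 2))) t =
      ENNReal.ofReal ((√(2 * Real.pi))⁻¹ * Real.exp (-(1 / 8) * t ^ 2)) := by
    intro t
    simp only [Pi.mul_apply, gaussianPDF, gaussianPDFReal]
    rw [← ENNReal.ofReal_mul (by positivity), mul_assoc, ← Real.exp_add]
    congr 2
    · simp
    · congr 1
      simp
      ring
  simp_rw [h]
  rw [← ofReal_integral_eq_lintegral_ofReal
    ((integrable_exp_neg_mul_sq (by norm_num : (0 : ℝ) < 1 / 8)).const_mul _)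
    (Eventually.of_forall fun t => by positivity), integral_const_mul, integral_gaussian]
  have : √(Real.pi / (1 / 8)) = 2 * √(2 * Real.pi) := by
    rw [show Real.pi / (1 / 8) = 2 ^ 2 * (2 * Real.pi) by ring, Real.sqrt_mul (by norm_num),
      Real.sqrt_sq (by norm_num)]
  rw [this, mul_left_comm, inv_mul_cancel₀ (by positivity)]
  simp

theorem lintegral_exp_dotProduct_gaussian {n : ℕ} (m c : Fin n → ℝ) :
    ∫⁻ y, ENNReal.ofReal (Real.exp (c ⬝ᵥ (y - m))) ∂(Measure.pi fun i => gaussianReal (m i) 1) =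
      ENNReal.ofReal (Real.exp (c ⬝ᵥ c / 2)) := by
  have h : ∀ y : Fin n → ℝ, ENNReal.ofReal (Real.exp (c ⬝ᵥ (y - m))) =
      ∏ i, (fun t => ENNReal.ofReal (Real.exp (c i * (t - m i)))) (y i) := by
    intro y
    simp only
    rw [← ENNReal.ofReal_prod_of_nonneg fun i _ => by positivity, ← Real.exp_sum]
    rfl
  simp_rw [h]
  rw [lintegral_pi_prod (fun i => gaussianReal (m i) 1)
    (fun i t => ENNReal.ofReal (Real.exp (c i * (t - m i)))) fun i => by fun_prop]
  simp_rw [lintegral_exp_mul_sub_gaussianReal]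
  rw [← ENNReal.ofReal_prod_of_nonneg fun i _ => by positivity, ← Real.exp_sum]
  congr 2
  simp [dotProduct, Finset.sum_div, sq]

/-- Linearization replaces rotation invariance: the exponential of the quadratic form is a Gaussian
mixture, over auxiliary `z`, of exponentials of linear forms in `y`. After exchanging the integrals,
the `y`-integral is explicit, and by `he` the remaining `z`-integral is a product of one-dimensional
ones. -/
theorem lintegral_exp_sum_sq_gaussian {n d : ℕ} (m : Fin n → ℝ) (e : Fin d → Fin n → ℝ)
    (he : ∀ z : Fin d → ℝ, (∑ i, z i • e i) ⬝ᵥ (∑ i, z i • e i) = ∑ i, z i ^ 2) :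
    ∫⁻ y, ENNReal.ofReal (Real.exp (3 / 8 * ∑ i, (e i ⬝ᵥ (y - m)) ^ 2))
      ∂(Measure.pi fun i => gaussianReal (m i) 1) = 2 ^ d := by
  set r : ℝ := √(3 / 4) with hr
  have hr2 : r ^ 2 = 3 / 4 := Real.sq_sqrt (by norm_num)
  have h1 : ∀ y : Fin n → ℝ, ENNReal.ofReal (Real.exp (3 / 8 * ∑ i, (e i ⬝ᵥ (y - m)) ^ 2)) =
      ∫⁻ z, ENNReal.ofReal (Real.exp ((r • ∑ i, z i • e i) ⬝ᵥ (y - m)))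
        ∂(Measure.pi fun _ : Fin d => gaussianReal 0 1) := by
    intro y
    have := lintegral_exp_dotProduct_gaussian (0 : Fin d → ℝ) fun i => r * (e i ⬝ᵥ (y - m))
    simp only [Pi.zero_apply, sub_zero] at this
    have ha : (fun i => r * (e i ⬝ᵥ (y - m))) ⬝ᵥ (fun i => r * (e i ⬝ᵥ (y - m))) / 2 =
        3 / 8 * ∑ i, (e i ⬝ᵥ (y - m)) ^ 2 := by
      rw [Finset.mul_sum, dotProduct, Finset.sum_div]
      refine Finset.sum_congr rfl fun i _ => ?_
      linear_combination ((e i ⬝ᵥ (y - m)) ^ 2 / 2) * hr2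
    rw [ha] at this
    rw [← this]
    refine lintegral_congr fun z => ?_
    congr 2
    rw [smul_dotProduct, sum_dotProduct, smul_eq_mul, Finset.mul_sum, dotProduct]
    refine Finset.sum_congr rfl fun i _ => ?_
    rw [smul_dotProduct, smul_eq_mul]
    ring
  simp_rw [h1]
  rw [lintegral_lintegral_swap]
  · simp_rw [lintegral_exp_dotProduct_gaussian]
    have h2 : ∀ z : Fin d → ℝ, ENNReal.ofReal (Real.exp
        ((r • ∑ i, z i • e i) ⬝ᵥ (r • ∑ i, z i • e i) / 2)) =
        ∏ i, (fun t => ENNReal.ofReal (Real.exp (3 / 8 * t ^ 2))) (z i) := by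
      intro z
      rw [← ENNReal.ofReal_prod_of_nonneg fun i _ => by positivity, ← Real.exp_sum,
        smul_dotProduct, dotProduct_smul, he z]
      congr 2
      rw [← Finset.mul_sum, smul_eq_mul, smul_eq_mul]
      linear_combination ((∑ i, z i ^ 2) / 2) * hr2
    simp_rw [h2]
    rw [lintegral_pi_prod (fun _ => gaussianReal 0 1)
      (fun _ t => ENNReal.ofReal (Real.exp (3 / 8 * t ^ 2))) fun i => by fun_prop]
    simp [lintegral_exp_sq_gaussianReal]
  · refine Measurable.aemeasurable ?_
    unfold Function.uncurry dotProduct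
    simp only [Pi.smul_apply, Finset.sum_apply]
    fun_prop

/-! ### Orthonormal families and projections in terms of `⬝ᵥ` -/

theorem toLp_inner {n : ℕ} (v w : Fin n → ℝ) :
    inner ℝ (WithLp.toLp 2 v) (WithLp.toLp 2 w) = v ⬝ᵥ w := by
  simp [PiLp.inner_apply, dotProduct, mul_comm]

/-- An orthonormal basis of `K`, with orthonormality expressed by Parseval's identity. The second
property is Cauchy-Schwarz in the coordinates of `w`: only the component of `y` in `K` matters. -/
theorem exists_orthonormal_family {n : ℕ} (K : Submodule ℝ (Fin n → ℝ)) :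
    ∃ e : Fin (Module.finrank ℝ K) → Fin n → ℝ,
      (∀ z : Fin (Module.finrank ℝ K) → ℝ,
        (∑ i, z i • e i) ⬝ᵥ (∑ i, z i • e i) = ∑ i, z i ^ 2) ∧
      ∀ w ∈ K, ∀ y : Fin n → ℝ, (y ⬝ᵥ w) ^ 2 ≤ (∑ i, (e i ⬝ᵥ y) ^ 2) * (w ⬝ᵥ w) := by
  let φ := (WithLp.linearEquiv 2 ℝ (Fin n → ℝ)).symm
  let K' : Submodule ℝ (EuclideanSpace ℝ (Fin n)) := K.map φ.toLinearMap
  have hfr : Module.finrank ℝ K' = Module.finrank ℝ K := LinearEquiv.finrank_map_eq φ K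
  let b : OrthonormalBasis (Fin (Module.finrank ℝ K)) ℝ K' :=
    (stdOrthonormalBasis ℝ K').reindex (finCongr hfr)
  let e : Fin (Module.finrank ℝ K) → Fin n → ℝ := fun i => (b i : EuclideanSpace ℝ (Fin n)).ofLp
  have he : ∀ z : Fin (Module.finrank ℝ K) → ℝ,
      WithLp.toLp 2 (∑ i, z i • e i) = ((∑ i, z i • b i : K') : EuclideanSpace ℝ (Fin n)) := by
    intro z
    ext j
    simp [e]
  have hnorm : ∀ z : Fin (Module.finrank ℝ K) → ℝ,
      (∑ i, z i • e i) ⬝ᵥ (∑ i, z i • e i) = ∑ i, z i ^ 2 := by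
    intro z
    rw [← toLp_inner, he, ← Submodule.coe_inner, b.orthonormal.inner_sum]
    simp [sq]
  refine ⟨e, hnorm, fun w hw y => ?_⟩
  have hw' : φ w ∈ K' := Submodule.mem_map_of_mem hw
  obtain ⟨c, hc⟩ : ∃ c : Fin (Module.finrank ℝ K) → ℝ, w = ∑ i, c i • e i := by
    refine ⟨b.repr ⟨φ w, hw'⟩, ?_⟩
    have h1 := b.sum_repr ⟨φ w, hw'⟩
    have h2 := he (b.repr ⟨φ w, hw'⟩)
    rw [h1] at h2
    exact (congrArg WithLp.ofLp h2).symm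
  rw [hc, hnorm, dotProduct_sum]
  simp only [dotProduct_smul, smul_eq_mul]
  rw [mul_comm (∑ i, _)]
  refine (Finset.sum_mul_sq_le_sq_mul_sq Finset.univ c fun i => y ⬝ᵥ e i).trans_eq ?_
  simp only [dotProduct_comm y]

/-- `M v` is a coefficient vector, supported in `S`, of the orthogonal projection of `X v` onto the
span of the columns in `S`. These columns may be dependent, so a linear right inverse chooses the
coefficients. -/
theorem exists_linear_projection {n p : ℕ} (X : Matrix (Fin n) (Fin p) ℝ) (S : Finset (Fin p)) :
    ∃ M : (Fin p → ℝ) →ₗ[ℝ] (Fin p → ℝ), (∀ v, ∀ i ∉ S, M v i = 0) ∧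
      ∀ v u : Fin p → ℝ, (∀ i ∉ S, u i = 0) → (X *ᵥ u) ⬝ᵥ (X *ᵥ (v - M v)) = 0 := by
  let V : Submodule ℝ (Fin p → ℝ) :=
    { carrier := {u | ∀ i ∉ S, u i = 0}
      add_mem' := fun {u v} hu hv i hi => by simp [hu i hi, hv i hi]
      zero_mem' := fun i _ => rfl
      smul_mem' := fun c u hu i hi => by simp [hu i hi] }
  let φ := (WithLp.linearEquiv 2 ℝ (Fin n → ℝ)).symm
  let A : (Fin p → ℝ) →ₗ[ℝ] EuclideanSpace ℝ (Fin n) := φ.toLinearMap ∘ₗ X.mulVecLin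
  let L : V →ₗ[ℝ] EuclideanSpace ℝ (Fin n) := A ∘ₗ V.subtype
  obtain ⟨g, hg⟩ := L.rangeRestrict.exists_rightInverse_of_surjective
    (LinearMap.range_rangeRestrict L)
  let M := V.subtype ∘ₗ g ∘ₗ (LinearMap.range L).orthogonalProjectionOnto.toLinearMap ∘ₗ A
  have hM : ∀ v, A (M v) = (LinearMap.range L).starProjection (A v) := by
    intro v
    have := congrArg (fun f => ((f ((LinearMap.range L).orthogonalProjectionOnto (A v)) :
      LinearMap.range L) : EuclideanSpace ℝ (Fin n))) hg
    exact this
  refine ⟨M, fun v i hi => (g _).2 i hi, fun v u hu => ?_⟩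
  rw [← toLp_inner, real_inner_comm]
  have h1 : WithLp.toLp 2 (X *ᵥ (v - M v)) =
      A v - (LinearMap.range L).starProjection (A v) := by
    rw [← hM, ← map_sub]; rfl
  rw [h1]
  exact Submodule.starProjection_inner_eq_zero (A v) _ ⟨⟨u, hu⟩, rfl⟩

/-! ### Norms, likelihoods and marginal likelihoods -/

variable {n p : ℕ}

theorem l2norm_sq {ι : Type*} [Fintype ι] (v : ι → ℝ) : l2norm v ^ 2 = v ⬝ᵥ v := by
  rw [l2norm, Real.sq_sqrt (Finset.sum_nonneg fun i _ => sq_nonneg _)]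
  simp [dotProduct, sq]

theorem l2norm_nonneg {ι : Type*} [Fintype ι] (v : ι → ℝ) : 0 ≤ l2norm v := Real.sqrt_nonneg _

theorem measurable_l2norm {ι : Type*} [Fintype ι] : Measurable (l2norm : (ι → ℝ) → ℝ) := by
  unfold l2norm; fun_prop

theorem l2norm_eq_norm {ι : Type*} [Fintype ι] (v : ι → ℝ) :
    l2norm v = ‖(WithLp.toLp 2 v : EuclideanSpace ℝ ι)‖ := by
  simp [l2norm, EuclideanSpace.norm_eq]

theorem measurable_mulVec (X : Matrix (Fin n) (Fin p) ℝ) :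
    Measurable fun β : Fin p → ℝ => X *ᵥ β := by
  unfold Matrix.mulVec dotProduct; fun_prop

theorem measurable_dotProduct {α : Type*} [MeasurableSpace α] {f g : α → Fin n → ℝ}
    (hf : Measurable f) (hg : Measurable g) : Measurable fun x => f x ⬝ᵥ g x := by
  unfold dotProduct; fun_prop

theorem measurable_likelihood_uncurry (X : Matrix (Fin n) (Fin p) ℝ) :
    Measurable fun z : (Fin n → ℝ) × (Fin p → ℝ) => likelihood X z.1 z.2 := by
  have h1 := measurable_mulVec X
  have h2 := measurable_l2norm (ι := Fin n)
  unfold likelihood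
  fun_prop

theorem measurable_likelihood (X : Matrix (Fin n) (Fin p) ℝ) (y : Fin n → ℝ) :
    Measurable (likelihood X y) := by
  have h1 := measurable_mulVec X
  have h2 := measurable_l2norm (ι := Fin n)
  unfold likelihood
  fun_prop

/-- The marginal likelihood of the model `S`. -/
def evidence (X : Matrix (Fin n) (Fin p) ℝ) (lam : ℝ) (S : Finset (Fin p)) (y : Fin n → ℝ) :
    ℝ≥0∞ :=
  ∫⁻ β, likelihood X y β ∂(modelPrior lam S)

theorem evidence_eq {lam : ℝ} (hlam : 0 < lam) (X : Matrix (Fin n) (Fin p) ℝ)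
    (S : Finset (Fin p)) (y : Fin n → ℝ) :
    evidence X lam S y = ∫⁻ u,
      ENNReal.ofReal ((lam / 2) ^ S.card * Real.exp (-lam * l1normOn S u)) * likelihood X y u
        ∂(coordVolume S) :=
  lintegral_modelPrior hlam S _ (measurable_likelihood X y)

theorem measurable_evidence {lam : ℝ} (hlam : 0 < lam) (X : Matrix (Fin n) (Fin p) ℝ)
    (S : Finset (Fin p)) : Measurable (evidence X lam S) := by
  simp_rw [funext (evidence_eq hlam X S)]
  have h1 := measurable_likelihood_uncurry X
  have h2 := measurable_l1normOn S
  refine Measurable.lintegral_prod_right' (f := fun z : (Fin n → ℝ) × (Fin p → ℝ) =>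
    ENNReal.ofReal ((lam / 2) ^ S.card * Real.exp (-lam * l1normOn S z.2)) *
      likelihood X z.1 z.2) ?_
  fun_prop

theorem l1normOn_nonneg (S : Finset (Fin p)) (β : Fin p → ℝ) : 0 ≤ l1normOn S β :=
  Finset.sum_nonneg fun _ _ => abs_nonneg _

theorem l1normOn_mono {S T : Finset (Fin p)} (h : S ⊆ T) (β : Fin p → ℝ) :
    l1normOn S β ≤ l1normOn T β :=
  Finset.sum_le_sum_of_subset_of_nonneg h fun _ _ _ => abs_nonneg _

theorem l1normOn_le (S : Finset (Fin p)) (β : Fin p → ℝ) :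
    l1normOn S β ≤ √S.card * l2norm β := by
  have h1 : l1normOn S β ^ 2 ≤ S.card * ∑ i ∈ S, β i ^ 2 := by
    have := sq_sum_le_card_mul_sum_sq (s := S) (f := fun i => |β i|)
    simpa [l1normOn] using this
  have h2 : ∑ i ∈ S, β i ^ 2 ≤ ∑ i, β i ^ 2 :=
    Finset.sum_le_sum_of_subset_of_nonneg (Finset.subset_univ _) fun _ _ _ => sq_nonneg _
  rw [l2norm, ← Real.sqrt_mul (by positivity)]
  exact Real.le_sqrt_of_sq_le (h1.trans (by gcongr))

/-! ### Small supersets: half moments of the evidence ratio -/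

/-- Comparison of the marginal likelihoods of two nested models. -/
theorem evidence_union_le {lam : ℝ} (hlam : 0 < lam) (X : Matrix (Fin n) (Fin p) ℝ)
    (S T : Finset (Fin p)) (hST : Disjoint S T) (M : (Fin p → ℝ) →ₗ[ℝ] (Fin p → ℝ))
    (hM : ∀ v, ∀ i ∉ S, M v i = 0)
    (hMX : ∀ v u : Fin p → ℝ, (∀ i ∉ S, u i = 0) → (X *ᵥ u) ⬝ᵥ (X *ᵥ (v - M v)) = 0)
    (β : Fin p → ℝ) (hβ : ∀ i ∉ S, β i = 0) (y : Fin n → ℝ) :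
    evidence X lam (S ∪ T) y ≤ evidence X lam S y *
      ∫⁻ v, ENNReal.ofReal ((lam / 2) ^ T.card * Real.exp (lam * l1normOn S (M v) +
        (y - X *ᵥ β) ⬝ᵥ (X *ᵥ (v - M v)) - l2norm (X *ᵥ (v - M v)) ^ 2 / 2))
        ∂(coordVolume T) := by
  have hl1 := measurable_l1normOn S
  have hl1' := measurable_l1normOn (S ∪ T)
  have hlik := measurable_likelihood X y
  have hX := measurable_mulVec X
  have hMm : Measurable M := M.continuous_of_finiteDimensional.measurable
  have hG : Measurable fun v => ENNReal.ofReal ((lam / 2) ^ T.card *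
      Real.exp (lam * l1normOn S (M v) +
        (y - X *ᵥ β) ⬝ᵥ (X *ᵥ (v - M v)) - l2norm (X *ᵥ (v - M v)) ^ 2 / 2)) := by
    have h1 : Measurable fun v => (y - X *ᵥ β) ⬝ᵥ (X *ᵥ (v - M v)) :=
      measurable_dotProduct measurable_const (by fun_prop)
    have := measurable_l2norm (ι := Fin n)
    fun_prop
  rw [evidence_eq hlam, lintegral_coordVolume_union S T hST _ (by fun_prop), evidence_eq hlam,
    ← lintegral_const_mul _ hG]
  refine lintegral_mono_ae ?_
  filter_upwards [ae_coordVolume T] with v hv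
  -- For fixed `v`, translating `u` by `-M v` replaces `X v` by its component orthogonal to the
  -- columns of `S`, so that the likelihood splits into a factor in `u` and one in `v`.
  rw [← lintegral_coordVolume_add_right S (-M v) (fun i hi => by simp [hM v i hi]) _
    (by fun_prop), ← lintegral_mul_const _ (by fun_prop)]
  refine lintegral_mono_ae ?_
  filter_upwards [ae_coordVolume S] with u hu
  unfold likelihood
  rw [← ENNReal.ofReal_mul (by positivity), ← ENNReal.ofReal_mul (by positivity),
    ← ENNReal.ofReal_mul (by positivity)]
  apply ENNReal.ofReal_le_ofReal
  rw [Finset.card_union_of_disjoint hST, pow_add]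
  have key : Real.exp (-lam * l1normOn (S ∪ T) (u + -M v + v)) *
      Real.exp (-l2norm (y - X *ᵥ (u + -M v + v)) ^ 2 / 2) ≤
      Real.exp (-lam * l1normOn S u) * Real.exp (-l2norm (y - X *ᵥ u) ^ 2 / 2) *
      Real.exp (lam * l1normOn S (M v) +
        (y - X *ᵥ β) ⬝ᵥ (X *ᵥ (v - M v)) - l2norm (X *ᵥ (v - M v)) ^ 2 / 2) := by
    rw [← Real.exp_add, ← Real.exp_add, ← Real.exp_add]
    apply Real.exp_le_exp.2
    -- The Laplace penalty on `T` is dropped, and the translation costs at most `lam * l1normOn S (M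
    -- v)`.
    have h1 : l1normOn S u - l1normOn S (M v) ≤ l1normOn (S ∪ T) (u + -M v + v) := by
      refine le_trans ?_ (l1normOn_mono Finset.subset_union_left _)
      rw [l1normOn, l1normOn, ← Finset.sum_sub_distrib]
      refine Finset.sum_le_sum fun i hi => ?_
      simp only [Pi.add_apply, Pi.neg_apply, hv i (Finset.disjoint_left.1 hST hi), add_zero]
      exact abs_sub_abs_le_abs_sub _ _
    have h2 : y - X *ᵥ (u + -M v + v) = (y - X *ᵥ u) - X *ᵥ (v - M v) := by
      rw [show u + -M v + v = u + (v - M v) by abel, Matrix.mulVec_add]; abel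
    -- Orthogonality allows `u` to be replaced by the true `β`, so the second factor depends on the
    -- noise alone.
    have h3 : (y - X *ᵥ u) ⬝ᵥ (X *ᵥ (v - M v)) = (y - X *ᵥ β) ⬝ᵥ (X *ᵥ (v - M v)) := by
      have := hMX v (β - u) fun i hi => by simp [hβ i hi, hu i hi]
      rw [Matrix.mulVec_sub, sub_dotProduct] at this
      rw [sub_dotProduct, sub_dotProduct]
      linarith
    rw [h2, l2norm_sq, l2norm_sq, l2norm_sq]
    simp only [sub_dotProduct (y - X *ᵥ u), dotProduct_sub _ (y - X *ᵥ u), h3,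
      dotProduct_comm (X *ᵥ (v - M v)) (y - X *ᵥ u)]
    nlinarith [mul_le_mul_of_nonneg_left h1 hlam.le]
  have := mul_le_mul_of_nonneg_left key
    (by positivity : 0 ≤ (lam / 2) ^ S.card * (lam / 2) ^ T.card)
  exact (le_of_eq (by ring)).trans (this.trans_eq (by ring))

theorem lintegral_exp_neg_l2norm_sq {b : ℝ} (hb : 0 < b) (T : Finset (Fin p)) :
    ∫⁻ v, ENNReal.ofReal (Real.exp (-b * l2norm v ^ 2)) ∂(coordVolume T) =
      ENNReal.ofReal (√(Real.pi / b) ^ T.card) := by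
  have h : ∀ v : Fin p → ℝ, ENNReal.ofReal (Real.exp (-b * l2norm v ^ 2)) =
      ∏ i, (fun t => ENNReal.ofReal (Real.exp (-b * t ^ 2))) (v i) := by
    intro v
    rw [← ENNReal.ofReal_prod_of_nonneg fun i _ => by positivity, ← Real.exp_sum, l2norm,
      Real.sq_sqrt (Finset.sum_nonneg fun i _ => sq_nonneg _), Finset.mul_sum]
  simp_rw [h]
  rw [lintegral_coordVolume_prod T (fun _ t => ENNReal.ofReal (Real.exp (-b * t ^ 2)))
    fun i => by fun_prop]
  rw [← ofReal_integral_eq_lintegral_ofReal (integrable_exp_neg_mul_sq hb)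
    (Eventually.of_forall fun t => by positivity), integral_gaussian]
  simp [ENNReal.ofReal_pow]

/-- The square root of the Gaussian mixture that compares two nested models has a bounded
expectation. -/
theorem lintegral_sqrt_mixture_le {lam c : ℝ} (hlam : 0 < lam) (hc : 0 < c)
    (X : Matrix (Fin n) (Fin p) ℝ)
    (S T : Finset (Fin p)) (hST : Disjoint S T) (M : (Fin p → ℝ) →ₗ[ℝ] (Fin p → ℝ))
    (hM : ∀ v, ∀ i ∉ S, M v i = 0)
    (hcX : ∀ v : Fin p → ℝ, (∀ i ∉ T, v i = 0) →
      c * l2norm (v - M v) ≤ l2norm (X *ᵥ (v - M v)))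
    (hκ : lam * √S.card ≤ c) (β : Fin p → ℝ) :
    ∫⁻ y, (∫⁻ v, ENNReal.ofReal ((lam / 2) ^ T.card * Real.exp (lam * l1normOn S (M v) +
        (y - X *ᵥ β) ⬝ᵥ (X *ᵥ (v - M v)) - l2norm (X *ᵥ (v - M v)) ^ 2 / 2))
        ∂(coordVolume T)) ^ (1 / 2 : ℝ) ∂(dataLaw X β) ≤
      ENNReal.ofReal (Real.exp (3 / 2) * (2 * √(lam / 2 * √(Real.pi / (c ^ 2 / 12)))) ^ T.card)
      := by
  let V : Submodule ℝ (Fin p → ℝ) := Submodule.span ℝ (Set.range fun i : T => Pi.single i.1 1)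
  let Q : (Fin p → ℝ) →ₗ[ℝ] (Fin n → ℝ) := X.mulVecLin ∘ₗ (LinearMap.id - M)
  have hV : ∀ v : Fin p → ℝ, (∀ i ∉ T, v i = 0) → v ∈ V := by
    intro v hv
    have : v = ∑ i : T, v i • (Pi.single i.1 1 : Fin p → ℝ) := by
      rw [Finset.sum_coe_sort T (fun i => v i • (Pi.single i 1 : Fin p → ℝ))]
      ext j
      simp only [Finset.sum_apply, Pi.smul_apply, smul_eq_mul, Pi.single_apply, mul_ite, mul_one,
        mul_zero, Finset.sum_ite_eq]
      split_ifs with h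
      · rfl
      · exact hv j h
    rw [this]
    exact Submodule.sum_mem _ fun i _ =>
      Submodule.smul_mem _ _ (Submodule.subset_span ⟨i, rfl⟩)
  obtain ⟨e, he, heq⟩ := exists_orthonormal_family (V.map Q)
  have hd : Module.finrank ℝ (V.map Q) ≤ T.card := by
    refine (Submodule.finrank_map_le Q V).trans ((finrank_range_le_card _).trans ?_)
    simp
  -- The first moment is no use: averaging over `y` cancels the quadratic term exactly and leaves a
  -- divergent integral over `v` if `T` is nonempty. A pointwise bound keeps Gaussian decay in `v`
  -- at the price of exp(3q/4), with q the squared length of the projected noise; this is integrable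
  -- only after a square root.
  have hbound : ∀ y, (∫⁻ v, ENNReal.ofReal ((lam / 2) ^ T.card *
        Real.exp (lam * l1normOn S (M v) +
        (y - X *ᵥ β) ⬝ᵥ (X *ᵥ (v - M v)) - l2norm (X *ᵥ (v - M v)) ^ 2 / 2))
        ∂(coordVolume T)) ≤
      ENNReal.ofReal (Real.exp (3 + 3 / 4 * ∑ i, (e i ⬝ᵥ (y - X *ᵥ β)) ^ 2) *
        (lam / 2 * √(Real.pi / (c ^ 2 / 12))) ^ T.card) := by
    intro y
    have hb : 0 < c ^ 2 / 12 := by positivity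
    rw [mul_pow, ← mul_assoc, ENNReal.ofReal_mul (by positivity),
      ← lintegral_exp_neg_l2norm_sq hb, ← lintegral_const_mul' _ _ ENNReal.ofReal_ne_top]
    refine lintegral_mono_ae ?_
    filter_upwards [ae_coordVolume T] with v hv
    rw [← ENNReal.ofReal_mul (by positivity)]
    apply ENNReal.ofReal_le_ofReal
    rw [mul_comm (Real.exp _), mul_assoc, ← Real.exp_add]
    gcongr
    set w := X *ᵥ (v - M v) with hw
    have hwmem : w ∈ V.map Q := ⟨v, hV v hv, rfl⟩
    have h1 := heq w hwmem (y - X *ᵥ β)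
    rw [← l2norm_sq] at h1
    set q := ∑ i, (e i ⬝ᵥ (y - X *ᵥ β)) ^ 2
    have hq : 0 ≤ q := Finset.sum_nonneg fun i _ => sq_nonneg _
    -- Cauchy-Schwarz, then the arithmetic-geometric mean inequality; the weights satisfy 4 · (3/4)
    -- · (1/3) = 1.
    have h2 : (y - X *ᵥ β) ⬝ᵥ w ≤ 3 / 4 * q + l2norm w ^ 2 / 3 := by
      refine abs_le_of_sq_le_sq' (h1.trans ?_) (by positivity) |>.2
      nlinarith [sq_nonneg (3 / 4 * q - l2norm w ^ 2 / 3)]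
    have hsq : l2norm (v - M v) ^ 2 = l2norm v ^ 2 + l2norm (M v) ^ 2 := by
      simp only [l2norm]
      rw [Real.sq_sqrt (by positivity), Real.sq_sqrt (by positivity),
        Real.sq_sqrt (by positivity), ← Finset.sum_add_distrib]
      refine Finset.sum_congr rfl fun i _ => ?_
      by_cases hi : i ∈ S
      · simp [hv i (Finset.disjoint_left.1 hST hi)]
      · simp [hM v i hi]
    have h3 : c ^ 2 * (l2norm v ^ 2 + l2norm (M v) ^ 2) ≤ l2norm w ^ 2 := by
      rw [← hsq, ← mul_pow]
      exact pow_le_pow_left₀ (mul_nonneg hc.le (l2norm_nonneg _)) (hcX v hv) 2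
    -- The smallness of `lam * √S.card` makes the cost of the translation at most linear in `l2norm
    -- w`.
    have h4 : lam * l1normOn S (M v) ≤ l2norm w := by
      calc lam * l1normOn S (M v) ≤ lam * (√S.card * l2norm (M v)) := by
            gcongr; exact l1normOn_le _ _
        _ = lam * √S.card * l2norm (M v) := by ring
        _ ≤ c * l2norm (M v) := mul_le_mul_of_nonneg_right hκ (l2norm_nonneg _)
        _ ≤ l2norm w := by
            refine le_of_sq_le_sq ?_ (l2norm_nonneg _)
            nlinarith [mul_nonneg (sq_nonneg c) (sq_nonneg (l2norm v))]
    -- Of the remaining -|w|²/6, one half absorbs the linear cost, |w| ≤ 3 + |w|²/12, and the other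
    -- half gives the decay -c²|v|²/12.
    nlinarith [sq_nonneg (l2norm w - 6), mul_nonneg (sq_nonneg c) (sq_nonneg (l2norm (M v)))]
  calc _ ≤ ∫⁻ y, ENNReal.ofReal (Real.exp (3 / 2) *
          √(lam / 2 * √(Real.pi / (c ^ 2 / 12))) ^ T.card) *
          ENNReal.ofReal (Real.exp (3 / 8 * ∑ i, (e i ⬝ᵥ (y - X *ᵥ β)) ^ 2)) ∂(dataLaw X β) := by
        refine lintegral_mono fun y => ?_
        refine (ENNReal.rpow_le_rpow (hbound y) (by norm_num)).trans_eq ?_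
        rw [ENNReal.ofReal_rpow_of_nonneg (by positivity) (by norm_num),
          ← ENNReal.ofReal_mul (by positivity)]
        congr 1
        rw [Real.mul_rpow (by positivity) (by positivity), ← Real.exp_mul, 
          ← Real.rpow_pow_comm (by positivity), ← Real.sqrt_eq_rpow, mul_right_comm, ← Real.exp_add]
        congr 2
        ring
    _ = ENNReal.ofReal (Real.exp (3 / 2) *
          √(lam / 2 * √(Real.pi / (c ^ 2 / 12))) ^ T.card) *
          2 ^ Module.finrank ℝ (V.map Q) := by
        rw [lintegral_const_mul' _ _ ENNReal.ofReal_ne_top, dataLaw,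
          lintegral_exp_sum_sq_gaussian _ e he]
    _ ≤ ENNReal.ofReal (Real.exp (3 / 2) *
          √(lam / 2 * √(Real.pi / (c ^ 2 / 12))) ^ T.card) * 2 ^ T.card := by
        gcongr
        norm_num
    _ = _ := by
        rw [mul_pow, show (2 : ℝ≥0∞) = ENNReal.ofReal 2 by simp,
          ← ENNReal.ofReal_pow (by norm_num), ← ENNReal.ofReal_mul (by positivity)]
        congr 1
        ring

instance (X : Matrix (Fin n) (Fin p) ℝ) (β : Fin p → ℝ) : IsProbabilityMeasure (dataLaw X β) := by
  unfold dataLaw; infer_instance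

/-! ### Large supersets: first moments on the noise event -/

theorem lintegral_exp_neg_abs_le {lam : ℝ} (hlam : 0 < lam) (m : ℝ) :
    ∫⁻ t, ENNReal.ofReal (lam / 2 * Real.exp (-(lam / 4) * |t - m|)) ≤ 4 := by
  have hr : 0 < lam / 4 := by positivity
  have hmeas : Measurable (exponentialPDF (lam / 4)) :=
    (measurable_exponentialPDFReal (lam / 4)).ennreal_ofReal
  have h1 : ∀ t, ENNReal.ofReal (lam / 2 * Real.exp (-(lam / 4) * |t|)) ≤
      2 * (exponentialPDF (lam / 4) t + exponentialPDF (lam / 4) (-t)) := by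
    intro t
    have h2 : ∀ x : ℝ, 0 ≤ x → ENNReal.ofReal (lam / 2 * Real.exp (-(lam / 4) * x)) =
        2 * exponentialPDF (lam / 4) x := by
      intro x hx
      rw [exponentialPDF_eq, if_pos hx, show (2 : ℝ≥0∞) = ENNReal.ofReal 2 by simp,
        ← ENNReal.ofReal_mul (by norm_num)]
      congr 1
      rw [neg_mul]
      ring
    rcases le_total 0 t with ht | ht
    · rw [abs_of_nonneg ht, h2 t ht]
      gcongr
      exact le_self_add
    · rw [abs_of_nonpos ht, h2 (-t) (by linarith)]
      gcongr
      exact le_add_self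
  calc _ = ∫⁻ t, ENNReal.ofReal (lam / 2 * Real.exp (-(lam / 4) * |t|)) :=
        lintegral_sub_right_eq_self
          (fun t => ENNReal.ofReal (lam / 2 * Real.exp (-(lam / 4) * |t|))) m
    _ ≤ ∫⁻ t, 2 * (exponentialPDF (lam / 4) t + exponentialPDF (lam / 4) (-t)) :=
        lintegral_mono h1
    _ = 4 := by
        rw [lintegral_const_mul _ (by fun_prop), lintegral_add_left hmeas,
          lintegral_neg_eq_self (exponentialPDF (lam / 4)), lintegral_exponentialPDF_eq_one hr]
        norm_num

theorem lintegral_exp_neg_l1_le {lam : ℝ} (hlam : 0 < lam) (S : Finset (Fin p))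
    (β₀ : Fin p → ℝ) :
    ∫⁻ u, ENNReal.ofReal ((lam / 2) ^ S.card *
      Real.exp (-(lam / 4) * l1normOn Finset.univ (u - β₀))) ∂(coordVolume S) ≤ 4 ^ S.card := by
  classical
  have h : ∀ u : Fin p → ℝ, ENNReal.ofReal ((lam / 2) ^ S.card *
      Real.exp (-(lam / 4) * l1normOn Finset.univ (u - β₀))) =
      ∏ i, (fun t => ENNReal.ofReal ((if i ∈ S then lam / 2 else 1) *
        Real.exp (-(lam / 4) * |t - β₀ i|))) (u i) := by
    intro u
    rw [← ENNReal.ofReal_prod_of_nonneg fun i _ => by split_ifs <;> positivity,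
      Finset.prod_mul_distrib, ← Real.exp_sum, ← Finset.mul_sum, Finset.prod_ite_mem]
    simp [l1normOn, div_pow]
  simp_rw [h]
  rw [lintegral_coordVolume_prod S (fun i t => ENNReal.ofReal ((if i ∈ S then lam / 2 else 1) *
        Real.exp (-(lam / 4) * |t - β₀ i|))) fun i => by fun_prop]
  have h1 : ∏ i ∈ S, ∫⁻ t, ENNReal.ofReal ((if i ∈ S then lam / 2 else 1) *
        Real.exp (-(lam / 4) * |t - β₀ i|)) ≤ 4 ^ S.card := by
    refine (Finset.prod_le_prod' fun i hi => ?_).trans_eq (Finset.prod_const _)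
    simp only [hi, if_true]
    exact lintegral_exp_neg_abs_le hlam _
  have h2 : ∏ i ∈ Sᶜ, ENNReal.ofReal ((if i ∈ S then lam / 2 else 1) *
        Real.exp (-(lam / 4) * |0 - β₀ i|)) ≤ 1 := by
    refine Finset.prod_le_one' fun i hi => ?_
    simp only [Finset.mem_compl.1 hi, if_false, one_mul]
    rw [ENNReal.ofReal_le_one, Real.exp_le_one_iff]
    nlinarith [mul_nonneg hlam.le (abs_nonneg (0 - β₀ i))]
  exact (mul_le_mul' h1 h2).trans_eq (mul_one _)

theorem l2norm_col_le (X : Matrix (Fin n) (Fin p) ℝ) (j : Fin p) :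
    l2norm (fun i => X i j) ≤ colNorm X :=
  le_ciSup (f := fun j => l2norm fun i => X i j) (Set.finite_range _).bddAbove j

theorem colNorm_nonneg (X : Matrix (Fin n) (Fin p) ℝ) : 0 ≤ colNorm X :=
  Real.iSup_nonneg fun _ => l2norm_nonneg _

theorem lamBar_nonneg (X : Matrix (Fin n) (Fin p) ℝ) : 0 ≤ lamBar X := by
  have := colNorm_nonneg X
  unfold lamBar; positivity

theorem mulVec_eq_sum_col (X : Matrix (Fin n) (Fin p) ℝ) (b : Fin p → ℝ) :
    X *ᵥ b = ∑ j, b j • fun i => X i j := by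
  ext i
  simp [Matrix.mulVec, dotProduct, mul_comm]

theorem l2norm_mulVec_le (X : Matrix (Fin n) (Fin p) ℝ) (b : Fin p → ℝ) :
    l2norm (X *ᵥ b) ≤ colNorm X * l1normOn Finset.univ b := by
  rw [mulVec_eq_sum_col, l2norm_eq_norm, WithLp.toLp_sum, l1normOn, Finset.mul_sum]
  refine (norm_sum_le _ _).trans (Finset.sum_le_sum fun j _ => ?_)
  rw [WithLp.toLp_smul, norm_smul, ← l2norm_eq_norm, mul_comm, Real.norm_eq_abs]
  exact mul_le_mul_of_nonneg_right (l2norm_col_le X j) (abs_nonneg _)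

/-- The event that the noise is nearly orthogonal to all columns of `X`. -/
def noiseEvent (X : Matrix (Fin n) (Fin p) ℝ) (β₀ : Fin p → ℝ) : Set (Fin n → ℝ) :=
  {y | ∀ j, |(fun i => X i j) ⬝ᵥ (y - X *ᵥ β₀)| ≤ lamBar X}

theorem measurableSet_noiseEvent (X : Matrix (Fin n) (Fin p) ℝ) (β₀ : Fin p → ℝ) :
    MeasurableSet (noiseEvent X β₀) := by
  rw [noiseEvent, Set.ofPred_forall]
  refine MeasurableSet.iInter fun j => measurableSet_le ?_ measurable_const
  have : Measurable fun y : Fin n → ℝ => (fun i => X i j) ⬝ᵥ (y - X *ᵥ β₀) :=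
    measurable_dotProduct measurable_const (by fun_prop)
  fun_prop

theorem abs_dotProduct_mulVec_le {X : Matrix (Fin n) (Fin p) ℝ} {β₀ : Fin p → ℝ} {y : Fin n → ℝ}
    (hy : y ∈ noiseEvent X β₀) (b : Fin p → ℝ) :
    |(X *ᵥ b) ⬝ᵥ (y - X *ᵥ β₀)| ≤ lamBar X * l1normOn Finset.univ b := by
  rw [mulVec_eq_sum_col, sum_dotProduct, l1normOn, Finset.mul_sum]
  refine (Finset.abs_sum_le_sum_abs _ _).trans (Finset.sum_le_sum fun j _ => ?_)
  rw [smul_dotProduct, smul_eq_mul, abs_mul, mul_comm]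
  exact mul_le_mul_of_nonneg_right (hy j) (abs_nonneg _)

theorem dataLaw_noiseEvent_compl_le (hp : 1 < p) (X : Matrix (Fin n) (Fin p) ℝ)
    (hX : 0 < colNorm X) (β₀ : Fin p → ℝ) :
    dataLaw X β₀ (noiseEvent X β₀)ᶜ ≤ ENNReal.ofReal (2 / p) := by
  have hp1 : (1 : ℝ) < p := by exact_mod_cast hp
  have hlog : 0 < Real.log p := Real.log_pos hp1
  have hone : ∀ c : Fin n → ℝ, l2norm c ≤ colNorm X →
      dataLaw X β₀ {y | lamBar X < c ⬝ᵥ (y - X *ᵥ β₀)} ≤ ENNReal.ofReal (1 / p ^ 2) := by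
    intro c hc
    -- The optimal Chernoff parameter for variance `colNorm X ^ 2`; it gives the exponent
    -- -λ̄²/(2‖X‖²) = -2 log p.
    set t := lamBar X / colNorm X ^ 2 with ht
    have ht0 : 0 ≤ t := div_nonneg (lamBar_nonneg X) (by positivity)
    have hmeas : Measurable fun y : Fin n → ℝ =>
        ENNReal.ofReal (Real.exp ((t • c) ⬝ᵥ (y - X *ᵥ β₀))) := by
      have : Measurable fun y : Fin n → ℝ => (t • c) ⬝ᵥ (y - X *ᵥ β₀) :=
        measurable_dotProduct measurable_const (by fun_prop)
      fun_prop
    have h1 := mul_meas_ge_le_lintegral (μ := dataLaw X β₀) hmeas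
      (ENNReal.ofReal (Real.exp (t * lamBar X)))
    rw [dataLaw, lintegral_exp_dotProduct_gaussian, ← dataLaw] at h1
    have h2 : {y | lamBar X < c ⬝ᵥ (y - X *ᵥ β₀)} ⊆ {y | ENNReal.ofReal (Real.exp (t * lamBar X))
        ≤ ENNReal.ofReal (Real.exp ((t • c) ⬝ᵥ (y - X *ᵥ β₀)))} := by
      intro y hy
      apply ENNReal.ofReal_le_ofReal
      apply Real.exp_le_exp.2
      rw [smul_dotProduct, smul_eq_mul]
      exact mul_le_mul_of_nonneg_left (le_of_lt hy) ht0
    refine (measure_mono h2).trans ?_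
    rw [mul_comm, ← ENNReal.le_div_iff_mul_le (by left; simp [Real.exp_pos]) (by simp)] at h1
    refine h1.trans ?_
    rw [← ENNReal.ofReal_div_of_pos (Real.exp_pos _), ← Real.exp_sub]
    apply ENNReal.ofReal_le_ofReal
    have h3 : (1 : ℝ) / p ^ 2 = Real.exp (-(2 * Real.log p)) := by
      rw [Real.exp_neg, mul_comm, Real.exp_mul, Real.exp_log (by positivity)]
      norm_num
    rw [h3]
    apply Real.exp_le_exp.2
    rw [smul_dotProduct, dotProduct_smul, ← l2norm_sq, smul_eq_mul, smul_eq_mul]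
    have h4 : l2norm c ^ 2 ≤ colNorm X ^ 2 := pow_le_pow_left₀ (l2norm_nonneg _) hc 2
    have h5 : t * lamBar X = 4 * Real.log p := by
      rw [ht, lamBar]
      field_simp
      rw [Real.sq_sqrt hlog.le]
      ring
    have h6 : t ^ 2 * colNorm X ^ 2 = 4 * Real.log p := by
      rw [← h5, ht]; field_simp
    nlinarith [mul_le_mul_of_nonneg_left h4 (sq_nonneg t)]
  have hsub : (noiseEvent X β₀)ᶜ ⊆ ⋃ j : Fin p,
      ({y | lamBar X < (fun i => X i j) ⬝ᵥ (y - X *ᵥ β₀)} ∪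
        {y | lamBar X < (-fun i => X i j) ⬝ᵥ (y - X *ᵥ β₀)}) := by
    intro y hy
    simp only [noiseEvent, Set.mem_compl_iff, Set.mem_ofPred_eq, not_forall, not_le] at hy
    obtain ⟨j, hj⟩ := hy
    rw [Set.mem_iUnion]
    refine ⟨j, ?_⟩
    rcases lt_abs.1 hj with h | h
    · exact Or.inl h
    · exact Or.inr (h.trans_eq (neg_dotProduct _ _).symm)
  refine (measure_mono hsub).trans ((measure_iUnion_fintype_le _ _).trans ?_)
  calc _ ≤ ∑ _j : Fin p, (ENNReal.ofReal (1 / p ^ 2) + ENNReal.ofReal (1 / p ^ 2)) := by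
        refine Finset.sum_le_sum fun j _ => (measure_union_le _ _).trans (add_le_add ?_ ?_)
        · exact hone _ (l2norm_col_le X j)
        · refine hone _ (le_trans (le_of_eq ?_) (l2norm_col_le X j))
          simp [l2norm]
    _ = ENNReal.ofReal (2 / p) := by
        rw [Finset.sum_const, Finset.card_univ, Fintype.card_fin, nsmul_eq_mul,
          ← ENNReal.ofReal_add (by positivity) (by positivity), ← ENNReal.ofReal_natCast,
          ← ENNReal.ofReal_mul (by positivity)]
        congr 1
        field_simp
        ring

/-- Lower bound on the marginal likelihood of the true model. -/
theorem le_evidence {lam r : ℝ} (hlam : 0 < lam) (X : Matrix (Fin n) (Fin p) ℝ)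
    (hlog : 1 ≤ Real.log p) (hX : 0 < colNorm X) (hlam2 : lam ≤ 2 * lamBar X)
    (S : Finset (Fin p)) (β₀ : Fin p → ℝ) (hβ₀ : ∀ i ∉ S, β₀ i = 0) (hr : 0 ≤ r)
    (hrS : S.card * r * lamBar X ≤ 1) {y : Fin n → ℝ} (hy : y ∈ noiseEvent X β₀) :
    ENNReal.ofReal (Real.exp (-(l2norm (y - X *ᵥ β₀) ^ 2 / 2 + lam * l1normOn S β₀) - 4) *
      (lam * r) ^ S.card) ≤ evidence X lam S y := by
  classical
  have hl1 := measurable_l1normOn S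
  have hlik := measurable_likelihood X y
  rw [evidence_eq hlam, ← lintegral_coordVolume_add_right S β₀ hβ₀ _ (by fun_prop)]
  -- Only the box of half-width `r` around `β₀` is kept; the Laplace normalization gives it the
  -- factor `(lam * r) ^ S.card`.
  let I : Set ℝ := Set.Icc (-r) r
  let g : Fin p → ℝ → ℝ≥0∞ := fun i =>
    if i ∈ S then I.indicator fun _ => ENNReal.ofReal (lam / 2) else fun _ => 1
  have hg : ∀ i, Measurable (g i) := by
    intro i
    simp only [g]
    split_ifs
    · exact measurable_const.indicator measurableSet_Icc
    · exact measurable_const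
  have hgint : ∫⁻ u, ∏ i, g i (u i) ∂(coordVolume S) = ENNReal.ofReal ((lam * r) ^ S.card) := by
    rw [lintegral_coordVolume_prod S g hg]
    have h1 : ∏ i ∈ Sᶜ, g i 0 = 1 :=
      Finset.prod_eq_one fun i hi => by simp [g, Finset.mem_compl.1 hi]
    have h2 : ∏ i ∈ S, ∫⁻ t, g i t = ∏ i ∈ S, ENNReal.ofReal (lam * r) := by
      refine Finset.prod_congr rfl fun i hi => ?_
      simp only [g, hi, if_true, I]
      rw [lintegral_indicator measurableSet_Icc, setLIntegral_const, Real.volume_Icc,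
        ← ENNReal.ofReal_mul (by positivity)]
      congr 1
      ring
    rw [h1, h2, mul_one, Finset.prod_const, ENNReal.ofReal_pow (by positivity)]
  rw [ENNReal.ofReal_mul (by positivity), ← hgint,
    ← lintegral_const_mul' _ _ ENNReal.ofReal_ne_top]
  refine lintegral_mono_ae ?_
  filter_upwards [ae_coordVolume S] with u hu
  by_cases hbox : ∀ i ∈ S, u i ∈ I
  · have hprod : ∏ i, g i (u i) = ENNReal.ofReal ((lam / 2) ^ S.card) := by
      rw [← Finset.prod_mul_prod_compl S,
        Finset.prod_congr rfl (g := fun _ => ENNReal.ofReal (lam / 2))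
          (fun i hi => by simp [g, hi, hbox i hi]),
        Finset.prod_congr rfl (s₁ := Sᶜ) (g := fun _ => 1)
          (fun i hi => by simp [g, Finset.mem_compl.1 hi])]
      rw [Finset.prod_const, Finset.prod_const_one, mul_one, ENNReal.ofReal_pow (by positivity)]
    unfold likelihood
    rw [hprod, ← ENNReal.ofReal_mul (by positivity), ← ENNReal.ofReal_mul (by positivity)]
    apply ENNReal.ofReal_le_ofReal
    rw [mul_comm, mul_assoc, ← Real.exp_add]
    gcongr
    have huniv : l1normOn Finset.univ u = l1normOn S u := by
      symm
      exact Finset.sum_subset (Finset.subset_univ S) fun i _ hi => by simp [hu i hi]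
    have hl : l1normOn S u ≤ S.card * r := by
      rw [← nsmul_eq_mul]
      exact Finset.sum_le_card_nsmul _ _ _ fun i hi => abs_le.2 (hbox i hi)
    have hl' : lamBar X * l1normOn S u ≤ 1 := by
      nlinarith [mul_le_mul_of_nonneg_left hl (lamBar_nonneg X)]
    have h1 := abs_dotProduct_mulVec_le hy u
    rw [huniv] at h1
    have h1' := (abs_le.1 h1).1
    have hsqrt : 1 ≤ √(Real.log p) := Real.one_le_sqrt.2 hlog
    have h2 : l2norm (X *ᵥ u) ≤ 1 := by
      refine (l2norm_mulVec_le X u).trans (le_trans ?_ hl')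
      rw [huniv]
      refine mul_le_mul_of_nonneg_right ?_ (l1normOn_nonneg _ _)
      rw [lamBar]; nlinarith
    have h3 : l2norm (X *ᵥ u) ^ 2 ≤ 1 := pow_le_one₀ (l2norm_nonneg _) h2
    have h4 : lam * l1normOn S u ≤ 2 :=
      (mul_le_mul_of_nonneg_right hlam2 (l1normOn_nonneg _ _)).trans (by linarith)
    have h5 : l1normOn S (u + β₀) ≤ l1normOn S u + l1normOn S β₀ := by
      rw [l1normOn, l1normOn, l1normOn, ← Finset.sum_add_distrib]
      exact Finset.sum_le_sum fun i _ => abs_add_le _ _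
    have h6 : l2norm (y - X *ᵥ (u + β₀)) ^ 2 = l2norm (y - X *ᵥ β₀) ^ 2 -
        2 * ((X *ᵥ u) ⬝ᵥ (y - X *ᵥ β₀)) + l2norm (X *ᵥ u) ^ 2 := by
      rw [Matrix.mulVec_add, show y - (X *ᵥ u + X *ᵥ β₀) = (y - X *ᵥ β₀) - X *ᵥ u by abel,
        l2norm_sq, l2norm_sq, l2norm_sq, sub_dotProduct (y - X *ᵥ β₀),
        dotProduct_sub _ (y - X *ᵥ β₀), dotProduct_sub _ (y - X *ᵥ β₀),
        dotProduct_comm (y - X *ᵥ β₀) (X *ᵥ u)]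
      ring
    -- On the box the noise term costs at most 1, the quadratic term 1/2 and the Laplace penalty 2;
    -- their sum 7/2 is rounded up to 4.
    rw [h6]
    nlinarith [mul_le_mul_of_nonneg_left h5 hlam.le]
  · push Not at hbox
    obtain ⟨i, hi, hiI⟩ := hbox
    rw [Finset.prod_eq_zero (Finset.mem_univ i) (by simp [g, hi, hiI]), mul_zero]
    exact bot_le

/-- Here `a` and `b` stand for the ℓ¹-norms of δ on and off the true support, and `w` for ‖Xδ‖₂.
After moving `lam / 4 * (a + b)` to the left, the linear part is λ(7a - b)/4. It is negative outside
the cone b ≤ 7a; inside the cone compatibility bounds `a` by a multiple of `w`, and completing the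
square absorbs the linear term into the quadratic one. -/
theorem compatibility_exponent_le {lam lb f N L a b w s : ℝ} (hlam : 0 < lam) (hN : 0 < N)
    (hL : 0 < L) (hlb : lb = 2 * N * √L) (hf : 0 < f) (hb : 0 ≤ b) (hs : 0 ≤ s)
    (h : b ≤ 7 * a → f * N * a ≤ w * √s) :
    lam * (a - b) + lam / 2 * (a + b) - lam / (4 * lb) * w ^ 2 ≤
      49 / 4 * s * (lam / lb / f ^ 2) * L - lam / 4 * (a + b) := by
  have hlb0 : 0 < lb := by rw [hlb]; positivity
  rcases le_or_gt b (7 * a) with hab | hab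
  · have h1 : a ≤ w * (√s / (f * N)) := by
      rw [← mul_div_assoc, le_div_iff₀ (by positivity)]
      linarith [h hab]
    set t := √s / (f * N) with ht
    have h2 : t ^ 2 * lb = 4 * s * L / (lb * f ^ 2) := by
      rw [ht, div_pow, Real.sq_sqrt hs]
      rw [div_mul_eq_mul_div, div_eq_div_iff (by positivity) (by positivity)]
      have : lb ^ 2 = 4 * N ^ 2 * L := by
        rw [hlb, mul_pow, Real.sq_sqrt hL.le]; ring
      linear_combination s * f ^ 2 * this
    have h3 : 7 / 4 * (w * t) ≤ w ^ 2 / (4 * lb) + 49 / 16 * (t ^ 2 * lb) := by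
      have : w ^ 2 / (4 * lb) + 49 / 16 * (t ^ 2 * lb) - 7 / 4 * (w * t) =
          (w - 7 / 2 * t * lb) ^ 2 / (4 * lb) := by
        field_simp
        ring
      have h4 : 0 ≤ (w - 7 / 2 * t * lb) ^ 2 / (4 * lb) := by positivity
      linarith
    rw [h2] at h3
    have h5 : 7 / 4 * a - w ^ 2 / (4 * lb) ≤ 49 / 16 * (4 * s * L / (lb * f ^ 2)) := by linarith
    have h6 := mul_le_mul_of_nonneg_left h5 hlam.le
    have h7 : lam * (7 / 4 * a - w ^ 2 / (4 * lb)) = 7 / 4 * lam * a - lam / (4 * lb) * w ^ 2 := by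
      ring
    have h8 : lam * (49 / 16 * (4 * s * L / (lb * f ^ 2))) =
        49 / 4 * s * (lam / lb / f ^ 2) * L := by
      field_simp
      ring
    rw [h7, h8] at h6
    nlinarith [mul_nonneg hlam.le hb]
  · have h1 : 0 ≤ 49 / 4 * s * (lam / lb / f ^ 2) * L := by positivity
    have h2 : 0 ≤ lam / (4 * lb) * w ^ 2 := by positivity
    nlinarith [mul_lt_mul_of_pos_left hab hlam]

/-- Upper bound on the expected marginal likelihood ratio of a model that contains the true
model. -/
theorem setLIntegral_evidence_le {lam f : ℝ} (hlam : 0 < lam) (X : Matrix (Fin n) (Fin p) ℝ)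
    (hlog : 0 < Real.log p) (hX : 0 < colNorm X) (hlam2 : lam ≤ 2 * lamBar X)
    (S₀ S : Finset (Fin p)) (β₀ : Fin p → ℝ) (hβ₀ : ∀ i ∉ S₀, β₀ i = 0)
    (hf : 0 < f) (hcompat : ∀ δ : Fin p → ℝ, l1normOn S₀ᶜ δ ≤ 7 * l1normOn S₀ δ →
      f * colNorm X * l1normOn S₀ δ ≤ l2norm (X *ᵥ δ) * √S₀.card) :
    ∫⁻ y in noiseEvent X β₀,
        ENNReal.ofReal (Real.exp (l2norm (y - X *ᵥ β₀) ^ 2 / 2 + lam * l1normOn S₀ β₀)) *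
          evidence X lam S y ∂(dataLaw X β₀) ≤
      ENNReal.ofReal (Real.exp (49 / 4 * S₀.card * (lam / lamBar X / f ^ 2) * Real.log p)) *
        4 ^ S.card := by
  have hl1 := measurable_l1normOn S
  have hlik := measurable_likelihood_uncurry X
  have hlik' := measurable_likelihood X
  have hl2 := measurable_l2norm (ι := Fin n)
  have hlb : 0 < lamBar X := by unfold lamBar; positivity
  simp_rw [evidence_eq hlam]
  have h1 : ∀ y : Fin n → ℝ,
      ENNReal.ofReal (Real.exp (l2norm (y - X *ᵥ β₀) ^ 2 / 2 + lam * l1normOn S₀ β₀)) *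
      (∫⁻ u, ENNReal.ofReal ((lam / 2) ^ S.card * Real.exp (-lam * l1normOn S u)) *
        likelihood X y u ∂(coordVolume S)) =
      ∫⁻ u, ENNReal.ofReal (Real.exp (l2norm (y - X *ᵥ β₀) ^ 2 / 2 + lam * l1normOn S₀ β₀)) *
        (ENNReal.ofReal ((lam / 2) ^ S.card * Real.exp (-lam * l1normOn S u)) *
        likelihood X y u) ∂(coordVolume S) := fun y =>
    (lintegral_const_mul' _ _ ENNReal.ofReal_ne_top).symm
  simp_rw [h1]
  rw [lintegral_lintegral_swap]
  swap
  · refine Measurable.aemeasurable ?_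
    unfold Function.uncurry
    fun_prop
  set G := 49 / 4 * (S₀.card : ℝ) * (lam / lamBar X / f ^ 2) * Real.log p with hG
  calc _ ≤ ∫⁻ u, ENNReal.ofReal (Real.exp G) * ENNReal.ofReal ((lam / 2) ^ S.card *
        Real.exp (-(lam / 4) * l1normOn Finset.univ (u - β₀))) ∂(coordVolume S) := ?_
    _ = ENNReal.ofReal (Real.exp G) * ∫⁻ u, ENNReal.ofReal ((lam / 2) ^ S.card *
        Real.exp (-(lam / 4) * l1normOn Finset.univ (u - β₀))) ∂(coordVolume S) :=
        lintegral_const_mul' _ _ ENNReal.ofReal_ne_top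
    _ ≤ _ := by gcongr; exact lintegral_exp_neg_l1_le hlam S β₀
  refine lintegral_mono_ae ?_
  filter_upwards [ae_coordVolume S] with u hu
  set δ := u - β₀ with hδ
  -- The noise term ⟨Xδ, ε⟩ is split. The fraction `α` is bounded on the noise event by (λ/2)‖δ‖₁,
  -- and the fraction 1 - α is integrated exactly. As (1 - α)² ≤ 1 - α, this leaves at least
  -- (α/2)‖Xδ‖² of the negative quadratic term for the compatibility argument.
  set α := lam / (2 * lamBar X) with hα
  have hα0 : 0 ≤ α := by positivity
  have hα1 : α ≤ 1 := by rw [hα, div_le_one (by positivity)]; exact hlam2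
  have hαlb : α * lamBar X = lam / 2 := by rw [hα]; field_simp
  set l := l1normOn Finset.univ δ with hl
  have hsum : l = l1normOn S₀ δ + l1normOn S₀ᶜ δ := (Finset.sum_add_sum_compl S₀ _).symm
  have hdiff : l1normOn S₀ β₀ - l1normOn S u ≤ l1normOn S₀ δ - l1normOn S₀ᶜ δ := by
    have h2 : l1normOn S u = l1normOn Finset.univ u :=
      Finset.sum_subset (Finset.subset_univ S) fun i _ hi => by simp [hu i hi]
    have h3 : l1normOn Finset.univ u = l1normOn S₀ u + l1normOn S₀ᶜ u :=
      (Finset.sum_add_sum_compl S₀ _).symm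
    have h4 : l1normOn S₀ᶜ u = l1normOn S₀ᶜ δ :=
      Finset.sum_congr rfl fun i hi => by simp [hδ, hβ₀ i (Finset.mem_compl.1 hi)]
    have h5 : l1normOn S₀ β₀ - l1normOn S₀ u ≤ l1normOn S₀ δ := by
      rw [l1normOn, l1normOn, l1normOn, ← Finset.sum_sub_distrib]
      refine Finset.sum_le_sum fun i _ => ?_
      rw [hδ, Pi.sub_apply, abs_sub_comm]
      exact abs_sub_abs_le_abs_sub _ _
    linarith
  set C := (lam / 2) ^ S.card * Real.exp (lam * (l1normOn S₀ δ - l1normOn S₀ᶜ δ) + lam / 2 * l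
    - l2norm (X *ᵥ δ) ^ 2 / 2) with hC
  have hpt : ∀ y ∈ noiseEvent X β₀,
      ENNReal.ofReal (Real.exp (l2norm (y - X *ᵥ β₀) ^ 2 / 2 + lam * l1normOn S₀ β₀)) *
        (ENNReal.ofReal ((lam / 2) ^ S.card * Real.exp (-lam * l1normOn S u)) *
        likelihood X y u) ≤ ENNReal.ofReal C *
        ENNReal.ofReal (Real.exp (((1 - α) • (X *ᵥ δ)) ⬝ᵥ (y - X *ᵥ β₀))) := by
    intro y hy
    unfold likelihood
    rw [← ENNReal.ofReal_mul (by positivity), ← ENNReal.ofReal_mul (by positivity),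
      ← ENNReal.ofReal_mul (by positivity)]
    apply ENNReal.ofReal_le_ofReal
    have h2 := (abs_le.1 (abs_dotProduct_mulVec_le hy δ)).2
    rw [← hl] at h2
    have h3 : l2norm (y - X *ᵥ u) ^ 2 = l2norm (y - X *ᵥ β₀) ^ 2 -
        2 * ((X *ᵥ δ) ⬝ᵥ (y - X *ᵥ β₀)) + l2norm (X *ᵥ δ) ^ 2 := by
      rw [show u = δ + β₀ by rw [hδ]; abel, Matrix.mulVec_add,
        show y - (X *ᵥ δ + X *ᵥ β₀) = (y - X *ᵥ β₀) - X *ᵥ δ by abel,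
        l2norm_sq, l2norm_sq, l2norm_sq, sub_dotProduct (y - X *ᵥ β₀),
        dotProduct_sub _ (y - X *ᵥ β₀), dotProduct_sub _ (y - X *ᵥ β₀),
        dotProduct_comm (y - X *ᵥ β₀) (X *ᵥ δ)]
      ring
    have h4 := mul_le_mul_of_nonneg_left h2 hα0
    rw [← mul_assoc, hαlb] at h4
    have key : Real.exp (l2norm (y - X *ᵥ β₀) ^ 2 / 2 + lam * l1normOn S₀ β₀) *
        Real.exp (-lam * l1normOn S u) * Real.exp (-l2norm (y - X *ᵥ u) ^ 2 / 2) ≤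
        Real.exp (lam * (l1normOn S₀ δ - l1normOn S₀ᶜ δ) + lam / 2 * l
          - l2norm (X *ᵥ δ) ^ 2 / 2) *
        Real.exp (((1 - α) • (X *ᵥ δ)) ⬝ᵥ (y - X *ᵥ β₀)) := by
      rw [← Real.exp_add, ← Real.exp_add, ← Real.exp_add]
      apply Real.exp_le_exp.2
      rw [h3, smul_dotProduct, smul_eq_mul]
      nlinarith [mul_le_mul_of_nonneg_left hdiff hlam.le]
    have := mul_le_mul_of_nonneg_left key (by positivity : 0 ≤ (lam / 2) ^ S.card)
    exact (le_of_eq (by ring)).trans (this.trans_eq (by ring))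
  refine (setLIntegral_mono' (measurableSet_noiseEvent X β₀) hpt).trans
    ((setLIntegral_le_lintegral _ _).trans ?_)
  rw [lintegral_const_mul' _ _ ENNReal.ofReal_ne_top, dataLaw, lintegral_exp_dotProduct_gaussian,
    ← ENNReal.ofReal_mul (by positivity), ← ENNReal.ofReal_mul (by positivity)]
  apply ENNReal.ofReal_le_ofReal
  have hexp := compatibility_exponent_le (w := l2norm (X *ᵥ δ)) hlam hX hlog
    (rfl : lamBar X = _) hf (l1normOn_nonneg S₀ᶜ δ)
    (Nat.cast_nonneg S₀.card) (hcompat δ)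
  rw [← hsum, ← hG] at hexp
  have h9 : lam / (4 * lamBar X) = α / 2 := by rw [hα]; field_simp; norm_num
  rw [h9] at hexp
  have key : Real.exp (lam * (l1normOn S₀ δ - l1normOn S₀ᶜ δ) + lam / 2 * l
      - l2norm (X *ᵥ δ) ^ 2 / 2) *
      Real.exp (((1 - α) • (X *ᵥ δ)) ⬝ᵥ ((1 - α) • (X *ᵥ δ)) / 2) ≤
      Real.exp G * Real.exp (-(lam / 4) * l) := by
    rw [← Real.exp_add, ← Real.exp_add]
    apply Real.exp_le_exp.2
    rw [smul_dotProduct, dotProduct_smul, ← l2norm_sq, smul_eq_mul, smul_eq_mul]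
    nlinarith [mul_nonneg (mul_nonneg hα0 (sub_nonneg.2 hα1)) (sq_nonneg (l2norm (X *ᵥ δ)))]
  have := mul_le_mul_of_nonneg_left key (by positivity : 0 ≤ (lam / 2) ^ S.card)
  exact (le_of_eq (by rw [hC]; ring)).trans (this.trans_eq (by ring))

/-! ### From posterior mass to posterior odds -/

theorem mem_support {β : Fin p → ℝ} {i : Fin p} : i ∈ support β ↔ β i ≠ 0 := by
  simp [support]

theorem eq_zero_of_notMem_support (β : Fin p → ℝ) : ∀ i ∉ support β, β i = 0 := by
  intro i hi
  simpa [support] using hi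

theorem measurableSet_ssubset_support (S₀ : Finset (Fin p)) :
    MeasurableSet {β : Fin p → ℝ | S₀ ⊂ support β} := by
  have h : {β : Fin p → ℝ | S₀ ⊂ support β} =
      (⋂ i ∈ S₀, {β | β i ≠ 0}) ∩ ⋃ i ∈ S₀ᶜ, {β | β i ≠ 0} := by
    ext β
    simp only [Set.mem_ofPred_eq, Finset.ssubset_iff_exists_cons_subset, Set.mem_inter_iff,
      Set.mem_iInter, Set.mem_iUnion, Finset.mem_compl, exists_prop]
    constructor
    · rintro ⟨i, hi, h⟩
      exact ⟨fun j hj => mem_support.1 (h (Finset.mem_cons.2 (Or.inr hj))), i, hi,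
        mem_support.1 (h (Finset.mem_cons_self i S₀))⟩
    · rintro ⟨h, i, hi, hβ⟩
      refine ⟨i, hi, fun j hj => mem_support.2 ?_⟩
      rcases Finset.mem_cons.1 hj with rfl | hj
      · exact hβ
      · exact h j hj
  have h1 : ∀ i : Fin p, MeasurableSet {β : Fin p → ℝ | β i ≠ 0} := fun i =>
    measurable_pi_apply (X := fun _ => ℝ) i (measurableSet_singleton (0 : ℝ)).compl
  rw [h]
  exact (Finset.measurableSet_biInter _ fun i _ => h1 i).inter
    (Finset.measurableSet_biUnion _ fun i _ => h1 i)

/-- The prior probability of the model `S`. -/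
def modelWeight (p : ℕ) (w : ℕ → ℝ) (S : Finset (Fin p)) : ℝ≥0∞ :=
  ENNReal.ofReal (w S.card / (p.choose S.card))

/-- The posterior odds of the model `S` relative to the model `S₀`. -/
def modelOdds (X : Matrix (Fin n) (Fin p) ℝ) (w : ℕ → ℝ) (lam : ℝ) (S₀ S : Finset (Fin p))
    (y : Fin n → ℝ) : ℝ≥0∞ :=
  (modelWeight p w S * evidence X lam S y) / (modelWeight p w S₀ * evidence X lam S₀ y)

theorem measurable_modelOdds {lam : ℝ} (hlam : 0 < lam) (X : Matrix (Fin n) (Fin p) ℝ)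
    (w : ℕ → ℝ) (S₀ S : Finset (Fin p)) : Measurable (modelOdds X w lam S₀ S) := by
  have h1 := measurable_evidence hlam X S
  have h2 := measurable_evidence hlam X S₀
  unfold modelOdds
  fun_prop

theorem posterior_le_one (X : Matrix (Fin n) (Fin p) ℝ) (w : ℕ → ℝ) (lam : ℝ)
    (y : Fin n → ℝ) (B : Set (Fin p → ℝ)) : posterior X w lam y B ≤ 1 :=
  (ENNReal.div_le_div_right (setLIntegral_le_lintegral _ _) _).trans ENNReal.div_self_le_one

/-- Under the prior of the model `S` the support is almost surely contained in `S`, so only strict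
supersets of `S₀` contribute to the numerator. The denominator is bounded below by the term of `S₀`.
-/
theorem posterior_ssubset_le {lam : ℝ} (hlam : 0 < lam) (X : Matrix (Fin n) (Fin p) ℝ)
    (w : ℕ → ℝ) (S₀ : Finset (Fin p)) (y : Fin n → ℝ) :
    posterior X w lam y {β | S₀ ⊂ support β} ≤
      ∑ T ∈ S₀ᶜ.powerset.erase ∅, modelOdds X w lam S₀ (S₀ ∪ T) y := by
  classical
  have hnum : ∫⁻ β in {β | S₀ ⊂ support β}, likelihood X y β ∂(prior p w lam) ≤
      ∑ T ∈ S₀ᶜ.powerset.erase ∅,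
        modelWeight p w (S₀ ∪ T) * evidence X lam (S₀ ∪ T) y := by
    have h1 : ∑ T ∈ S₀ᶜ.powerset.erase ∅,
        modelWeight p w (S₀ ∪ T) * evidence X lam (S₀ ∪ T) y =
        ∑ S ∈ Finset.univ.filter (S₀ ⊂ ·), modelWeight p w S * evidence X lam S y := by
      refine Finset.sum_nbij' (S₀ ∪ ·) (· \ S₀) ?_ ?_ ?_ ?_ fun _ _ => rfl
      · intro T hT
        rw [Finset.mem_erase, Finset.mem_powerset] at hT
        simp only [Finset.mem_filter, Finset.mem_univ, true_and]
        refine Finset.ssubset_iff_subset_ne.2 ⟨Finset.subset_union_left, fun h => hT.1 ?_⟩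
        have h2 : T ⊆ S₀ := by rw [h]; exact Finset.subset_union_right
        exact Finset.eq_empty_of_forall_notMem fun i hi =>
          Finset.mem_compl.1 (hT.2 hi) (h2 hi)
      · intro S hS
        simp only [Finset.mem_filter, Finset.mem_univ, true_and] at hS
        rw [Finset.mem_erase, Finset.mem_powerset]
        refine ⟨fun h => hS.2 (Finset.sdiff_eq_empty_iff_subset.1 h), fun i hi => ?_⟩
        exact Finset.mem_compl.2 (Finset.mem_sdiff.1 hi).2
      · intro T hT
        rw [Finset.mem_erase, Finset.mem_powerset] at hT
        refine Finset.union_sdiff_cancel_left (Finset.disjoint_left.2 fun i hi hiT => ?_)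
        exact Finset.mem_compl.1 (hT.2 hiT) hi
      · intro S hS
        simp only [Finset.mem_filter, Finset.mem_univ, true_and] at hS
        exact Finset.union_sdiff_of_subset hS.1
    rw [h1, ← lintegral_indicator (measurableSet_ssubset_support S₀), prior,
      lintegral_finsetSum_measure, Finset.sum_filter]
    refine Finset.sum_le_sum fun S _ => ?_
    rw [lintegral_smul_measure, smul_eq_mul]
    split_ifs with hS
    · unfold modelWeight evidence
      gcongr
      exact Set.indicator_le_self _ _ _
    · have h2 : ∫⁻ β, {β : Fin p → ℝ | S₀ ⊂ support β}.indicator (likelihood X y) β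
          ∂(modelPrior lam S) = 0 := by
        rw [← lintegral_zero (μ := modelPrior lam S)]
        refine lintegral_congr_ae ?_
        filter_upwards [ae_modelPrior hlam S] with u hu
        refine Set.indicator_of_notMem (fun hmem => hS ?_) _
        refine lt_of_lt_of_le hmem fun i hi => ?_
        by_contra hiS
        exact mem_support.1 hi (hu i hiS)
      exact le_of_eq (by rw [h2, mul_zero])
  have hden : modelWeight p w S₀ * evidence X lam S₀ y ≤
      ∫⁻ β, likelihood X y β ∂(prior p w lam) := by
    rw [prior, lintegral_finsetSum_measure]
    simp_rw [lintegral_smul_measure, smul_eq_mul]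
    exact Finset.single_le_sum
      (f := fun S => modelWeight p w S * evidence X lam S y) (fun _ _ => bot_le)
      (Finset.mem_univ S₀)
  refine (ENNReal.div_le_div hnum hden).trans_eq ?_
  simp only [modelOdds, div_eq_mul_inv, Finset.sum_mul]

theorem min_one_le_rpow_half (x : ℝ≥0∞) : min 1 x ≤ x ^ (1 / 2 : ℝ) := by
  rcases le_total x 1 with h | h
  · rw [min_eq_right h]
    simpa using ENNReal.rpow_le_rpow_of_exponent_ge h (by norm_num : (1 / 2 : ℝ) ≤ 1)
  · rw [min_eq_left h]
    exact ENNReal.one_le_rpow h (by norm_num)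

theorem sum_rpow_half_le {ι : Type*} (s : Finset ι) (f : ι → ℝ≥0∞) :
    (∑ i ∈ s, f i) ^ (1 / 2 : ℝ) ≤ ∑ i ∈ s, f i ^ (1 / 2 : ℝ) := by
  classical
  induction s using Finset.induction_on with
  | empty => simp
  | insert i s hi ih =>
    rw [Finset.sum_insert hi, Finset.sum_insert hi]
    exact (ENNReal.rpow_add_le_add_rpow _ _ (by norm_num) (by norm_num)).trans (by gcongr)

open Classical in
/-- Large supersets are handled by a first moment bound on the noise event, small supersets by
moments of order one half. -/
theorem lintegral_posterior_le {lam : ℝ} (hlam : 0 < lam) (X : Matrix (Fin n) (Fin p) ℝ)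
    (w : ℕ → ℝ) (β₀ : Fin p → ℝ) (P : ℕ → Prop) :
    ∫⁻ y, posterior X w lam y {β | support β₀ ⊂ support β} ∂(dataLaw X β₀) ≤
      dataLaw X β₀ (noiseEvent X β₀)ᶜ + ∑ T ∈ (support β₀)ᶜ.powerset.erase ∅,
        if P T.card then
          ∫⁻ y in noiseEvent X β₀, modelOdds X w lam (support β₀) (support β₀ ∪ T) y
            ∂(dataLaw X β₀)
        else ∫⁻ y, modelOdds X w lam (support β₀) (support β₀ ∪ T) y ^ (1 / 2 : ℝ)
            ∂(dataLaw X β₀) := by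
  set S₀ := support β₀
  set N := noiseEvent X β₀
  have hN : MeasurableSet N := measurableSet_noiseEvent X β₀
  have hodds := fun T => measurable_modelOdds hlam X w S₀ (S₀ ∪ T)
  let g : Finset (Fin p) → (Fin n → ℝ) → ℝ≥0∞ := fun T =>
    if P T.card then N.indicator (modelOdds X w lam S₀ (S₀ ∪ T))
    else fun y => modelOdds X w lam S₀ (S₀ ∪ T) y ^ (1 / 2 : ℝ)
  have hg : ∀ T, Measurable (g T) := by
    intro T
    have := hodds T
    simp only [g]
    split_ifs
    · exact this.indicator hN
    · fun_prop
  have hpt : ∀ y, posterior X w lam y {β | S₀ ⊂ support β} ≤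
      Nᶜ.indicator 1 y + ∑ T ∈ S₀ᶜ.powerset.erase ∅, g T y := by
    intro y
    by_cases hy : y ∈ N
    · refine le_trans ?_ le_add_self
      have h1 := posterior_ssubset_le hlam X w S₀ y
      rw [← Finset.sum_filter_add_sum_filter_not _ (fun T => P T.card)] at h1 ⊢
      set A := ∑ T ∈ S₀ᶜ.powerset.erase ∅ with P T.card, modelOdds X w lam S₀ (S₀ ∪ T) y
      set B := ∑ T ∈ S₀ᶜ.powerset.erase ∅ with ¬ P T.card, modelOdds X w lam S₀ (S₀ ∪ T) y
        with hB
      have hAg : ∑ T ∈ S₀ᶜ.powerset.erase ∅ with P T.card, g T y = A :=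
        Finset.sum_congr rfl fun T hT => by simp [g, (Finset.mem_filter.1 hT).2, hy]
      have hBg : B ^ (1 / 2 : ℝ) ≤ ∑ T ∈ S₀ᶜ.powerset.erase ∅ with ¬ P T.card, g T y := by
        refine (sum_rpow_half_le _ _).trans_eq (Finset.sum_congr rfl fun T hT => ?_)
        simp [g, (Finset.mem_filter.1 hT).2]
      rw [hAg]
      -- The trivial bound 1 is spent on `B` alone, where min(1, B) ≤ √B and the square root is
      -- subadditive; `A` keeps its first power.
      calc _ ≤ min 1 (A + B) := le_min (posterior_le_one _ _ _ _ _) h1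
        _ ≤ A + min 1 B := by
            rcases le_total 1 B with h | h
            · rw [min_eq_left h]; exact (min_le_left _ _).trans le_add_self
            · rw [min_eq_right h]; exact min_le_right _ _
        _ ≤ _ := by gcongr; exact (min_one_le_rpow_half B).trans hBg
    · refine (posterior_le_one _ _ _ _ _).trans (le_trans ?_ le_self_add)
      simp [hy]
  refine (lintegral_mono hpt).trans_eq ?_
  rw [lintegral_add_left (measurable_one.indicator hN.compl), lintegral_indicator_one hN.compl,
    lintegral_finsetSum _ fun T _ => hg T]
  congr 1
  refine Finset.sum_congr rfl fun T _ => ?_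
  simp only [g]
  split_ifs
  · exact lintegral_indicator hN _
  · rfl

theorem modelOdds_eq (X : Matrix (Fin n) (Fin p) ℝ) {w : ℕ → ℝ} (hw : ∀ s ≤ p, 0 < w s)
    (lam : ℝ) (S₀ S : Finset (Fin p)) (y : Fin n → ℝ) :
    modelOdds X w lam S₀ S y = ENNReal.ofReal ((w S.card / p.choose S.card) /
      (w S₀.card / p.choose S₀.card)) * (evidence X lam S y / evidence X lam S₀ y) := by
  have hcard : S₀.card ≤ p := by simpa using S₀.card_le_univ
  have h1 : 0 < w S₀.card / p.choose S₀.card :=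
    div_pos (hw _ hcard) (by exact_mod_cast Nat.choose_pos hcard)
  rw [modelOdds, ENNReal.ofReal_div_of_pos h1, modelWeight, modelWeight,
    ENNReal.mul_div_mul_comm (Or.inl (by simpa using h1)) (Or.inl ENNReal.ofReal_ne_top)]

theorem setLIntegral_modelOdds_le {lam f r : ℝ} (hlam : 0 < lam) (X : Matrix (Fin n) (Fin p) ℝ)
    {w : ℕ → ℝ} (hw : ∀ s ≤ p, 0 < w s)
    (hlog : 1 ≤ Real.log p) (hX : 0 < colNorm X) (hlam2 : lam ≤ 2 * lamBar X)
    (S₀ S : Finset (Fin p)) (β₀ : Fin p → ℝ) (hβ₀ : ∀ i ∉ S₀, β₀ i = 0)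
    (hf : 0 < f) (hcompat : ∀ δ : Fin p → ℝ, l1normOn S₀ᶜ δ ≤ 7 * l1normOn S₀ δ →
      f * colNorm X * l1normOn S₀ δ ≤ l2norm (X *ᵥ δ) * √S₀.card)
    (hr : 0 < r) (hrS : S₀.card * r * lamBar X ≤ 1) :
    ∫⁻ y in noiseEvent X β₀, modelOdds X w lam S₀ S y ∂(dataLaw X β₀) ≤
      ENNReal.ofReal ((w S.card / p.choose S.card) / (w S₀.card / p.choose S₀.card) *
        (Real.exp 4 / (lam * r) ^ S₀.card *
        (Real.exp (49 / 4 * S₀.card * (lam / lamBar X / f ^ 2) * Real.log p) * 4 ^ S.card))) := by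
  have hcard : S₀.card ≤ p := by simpa using S₀.card_le_univ
  have hcardS : S.card ≤ p := by simpa using S.card_le_univ
  have hρ : 0 ≤ (w S.card / p.choose S.card) / (w S₀.card / p.choose S₀.card) :=
    div_nonneg (div_nonneg (hw _ hcardS).le (by positivity))
      (div_nonneg (hw _ hcard).le (by positivity))
  simp_rw [modelOdds_eq X hw]
  rw [lintegral_const_mul' _ _ ENNReal.ofReal_ne_top, ENNReal.ofReal_mul hρ]
  gcongr
  have hd : 0 < (lam * r) ^ S₀.card := by positivity
  have hpt : ∀ y ∈ noiseEvent X β₀, evidence X lam S y / evidence X lam S₀ y ≤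
      ENNReal.ofReal (Real.exp 4 / (lam * r) ^ S₀.card) *
      (ENNReal.ofReal (Real.exp (l2norm (y - X *ᵥ β₀) ^ 2 / 2 + lam * l1normOn S₀ β₀)) *
        evidence X lam S y) := by
    intro y hy
    refine (ENNReal.div_le_div_left
      (le_evidence hlam X hlog hX hlam2 S₀ β₀ hβ₀ hr.le hrS hy) _).trans_eq ?_
    rw [← mul_assoc, ← ENNReal.ofReal_mul (by positivity),
      mul_comm (ENNReal.ofReal _) (evidence X lam S y), div_eq_mul_inv,
      ← ENNReal.ofReal_inv_of_pos (by positivity)]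
    congr 2
    rw [Real.exp_sub, Real.exp_neg]
    field_simp
  refine (setLIntegral_mono' (measurableSet_noiseEvent X β₀) hpt).trans ?_
  rw [lintegral_const_mul' _ _ ENNReal.ofReal_ne_top, ENNReal.ofReal_mul (by positivity)]
  gcongr
  refine (setLIntegral_evidence_le hlam X (by linarith) hX hlam2 S₀ S β₀ hβ₀ hf
    hcompat).trans_eq ?_
  rw [ENNReal.ofReal_mul (by positivity)]
  simp [ENNReal.ofReal_pow]

theorem lintegral_sqrt_modelOdds_le {lam c : ℝ} (hlam : 0 < lam) (X : Matrix (Fin n) (Fin p) ℝ)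
    {w : ℕ → ℝ} (hw : ∀ s ≤ p, 0 < w s) (hc : 0 < c)
    (S₀ T : Finset (Fin p)) (hT : Disjoint S₀ T) (β₀ : Fin p → ℝ) (hβ₀ : ∀ i ∉ S₀, β₀ i = 0)
    (hcX : ∀ v : Fin p → ℝ, (∀ i ∉ S₀ ∪ T, v i = 0) → c * l2norm v ≤ l2norm (X *ᵥ v))
    (hκ : lam * √S₀.card ≤ c) :
    ∫⁻ y, modelOdds X w lam S₀ (S₀ ∪ T) y ^ (1 / 2 : ℝ) ∂(dataLaw X β₀) ≤
      ENNReal.ofReal (√((w (S₀ ∪ T).card / p.choose (S₀ ∪ T).card) /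
        (w S₀.card / p.choose S₀.card)) *
        (Real.exp (3 / 2) * (2 * √(lam / 2 * √(Real.pi / (c ^ 2 / 12)))) ^ T.card)) := by
  obtain ⟨M, hM, hMX⟩ := exists_linear_projection X S₀
  have hρ : 0 ≤ (w (S₀ ∪ T).card / p.choose (S₀ ∪ T).card) / (w S₀.card / p.choose S₀.card) := by
    have h1 : S₀.card ≤ p := by simpa using S₀.card_le_univ
    have h2 : (S₀ ∪ T).card ≤ p := by simpa using (S₀ ∪ T).card_le_univ
    exact div_nonneg (div_nonneg (hw _ h2).le (by positivity))
      (div_nonneg (hw _ h1).le (by positivity))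
  have hmix := lintegral_sqrt_mixture_le hlam hc X S₀ T hT M hM (fun v hv => hcX _ fun i hi => by
    rw [Finset.mem_union, not_or] at hi
    simp [hv i hi.2, hM v i hi.1]) hκ β₀
  rw [ENNReal.ofReal_mul (by positivity)]
  refine le_trans ?_ (mul_le_mul_right hmix _)
  rw [← lintegral_const_mul' _ _ ENNReal.ofReal_ne_top]
  refine lintegral_mono fun y => ?_
  rw [modelOdds_eq X hw, ENNReal.mul_rpow_of_nonneg _ _ (by norm_num),
    ENNReal.ofReal_rpow_of_nonneg hρ (by norm_num), ← Real.sqrt_eq_rpow]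
  gcongr
  refine (ENNReal.div_le_div_right
    (evidence_union_le hlam X S₀ T hT M hM hMX β₀ hβ₀ y) _).trans ?_
  rw [mul_comm, mul_div_assoc]
  exact (mul_le_mul_right ENNReal.div_self_le_one _).trans_eq (mul_one _)

/-! ### Design constants, the dimension prior and the counting of models -/

/-- What the compatibility and sparse singular value conditions give for real numbers. -/
theorem exists_compat_constant {lam A₄ c₀ : ℝ} (hlam : 0 < lam) (hA₄ : 0 < A₄) (hc₀ : 0 < c₀)
    (X : Matrix (Fin n) (Fin p) ℝ) (hX : 0 < colNorm X) (S : Finset (Fin p))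
    (hcompat : ENNReal.ofReal c₀ ≤ compat X S) (hpsi : ENNReal.ofReal c₀ ≤ psiTilde X lam A₄ S) :
    ∃ f : ℝ, 0 < f ∧ (S.card ≠ 0 → c₀ ≤ f) ∧
      (∀ δ : Fin p → ℝ, l1normOn Sᶜ δ ≤ 7 * l1normOn S δ →
        f * colNorm X * l1normOn S δ ≤ l2norm (X *ᵥ δ) * √S.card) ∧
      ∀ v : Fin p → ℝ,
        ((support v).card : ℝ) ≤ (2 + 3 / A₄ + 33 * (lam / lamBar X / f ^ 2)) * S.card →
        c₀ * colNorm X * l2norm v ≤ l2norm (X *ᵥ v) := by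
  have hSV : ∀ d : ℝ, ENNReal.ofReal c₀ ≤ smallestSV X (ENNReal.ofReal d) →
      ∀ v : Fin p → ℝ, ((support v).card : ℝ) ≤ d →
        c₀ * colNorm X * l2norm v ≤ l2norm (X *ᵥ v) := by
    intro d hd v hv
    rcases eq_or_ne v 0 with rfl | hv0
    · simp [l2norm]
    have h1 : smallestSV X (ENNReal.ofReal d) ≤
        ENNReal.ofReal (l2norm (X *ᵥ v) / (colNorm X * l2norm v)) := by
      refine iInf_le_of_le v (iInf₂_le_of_le hv0 ?_ le_rfl)
      rw [← ENNReal.ofReal_natCast]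
      exact ENNReal.ofReal_le_ofReal hv
    have hv' : 0 < l2norm v := by
      rw [l2norm_eq_norm, norm_pos_iff]
      simpa using hv0
    have h2 := (ENNReal.ofReal_le_ofReal_iff (div_nonneg (l2norm_nonneg _) (by positivity))).1
      (hd.trans h1)
    rw [le_div_iff₀ (by positivity)] at h2
    linarith
  rcases S.eq_empty_or_nonempty with rfl | hS
  -- For the empty model `compat` is ∞ and has no real value. Any positive `f` serves, because every
  -- occurrence of it is multiplied by 0.
  · refine ⟨1, one_pos, by simp, fun δ _ => by simp [l1normOn], fun v hv => hSV 0 ?_ v ?_⟩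
    · simpa [psiTilde] using hpsi
    · simpa using hv
  have hle : ∀ δ : Fin p → ℝ, l1normOn Sᶜ δ ≤ 7 * l1normOn S δ → (∃ i ∈ S, δ i ≠ 0) →
      compat X S ≤ ENNReal.ofReal (l2norm (X *ᵥ δ) * √(S.card : ℝ) /
        (colNorm X * l1normOn S δ)) :=
    fun δ h1 h2 => iInf_le_of_le δ (iInf₂_le_of_le h1 h2 le_rfl)
  -- The indicator of a nonempty `S` is admissible in the infimum.
  have htop : compat X S ≠ ⊤ := by
    obtain ⟨i, hi⟩ := hS
    refine ne_top_of_le_ne_top ENNReal.ofReal_ne_top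
      (hle (fun j => if j ∈ S then 1 else 0) ?_ ⟨i, hi, by simp [hi]⟩)
    have h1 : l1normOn Sᶜ (fun j => if j ∈ S then (1 : ℝ) else 0) = 0 :=
      Finset.sum_eq_zero fun j hj => by simp [Finset.mem_compl.1 hj]
    rw [h1]
    have := l1normOn_nonneg S (fun j => if j ∈ S then (1 : ℝ) else 0)
    positivity
  set f := (compat X S).toReal with hfdef
  have hf : compat X S = ENNReal.ofReal f := (ENNReal.ofReal_toReal htop).symm
  have hcf : c₀ ≤ f := by
    rw [hf] at hcompat
    exact (ENNReal.ofReal_le_ofReal_iff ENNReal.toReal_nonneg).1 hcompat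
  have hf0 : 0 < f := hc₀.trans_le hcf
  refine ⟨f, hf0, fun _ => hcf, fun δ hδ => ?_, hSV _ ?_⟩
  · rcases (l1normOn_nonneg S δ).eq_or_lt with h0 | h0
    · rw [← h0, mul_zero]
      exact mul_nonneg (l2norm_nonneg _) (Real.sqrt_nonneg _)
    have hex : ∃ i ∈ S, δ i ≠ 0 := by
      by_contra! hcon
      exact h0.ne' (Finset.sum_eq_zero fun i hi => by simp [hcon i hi])
    have h1 := hle δ hδ hex
    rw [hf, ENNReal.ofReal_le_ofReal_iff (div_nonneg (mul_nonneg (l2norm_nonneg _)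
      (Real.sqrt_nonneg _)) (by positivity)), le_div_iff₀ (by positivity)] at h1
    linarith
  · have hlb : 0 ≤ lam / lamBar X := div_nonneg hlam.le (lamBar_nonneg X)
    convert hpsi using 1
    rw [psiTilde]
    congr 1
    rw [hf, ← ENNReal.ofReal_pow hf0.le, show (33 : ℝ≥0∞) = ENNReal.ofReal 33 by simp,
      ← ENNReal.ofReal_div_of_pos (by positivity), ← ENNReal.ofReal_mul (by positivity),
      ← ENNReal.ofReal_add (by positivity) (by positivity), ← ENNReal.ofReal_natCast,
      ← ENNReal.ofReal_mul (by positivity)]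
    congr 2
    ring

/-- If `w 0` vanished, the upper bounds would make all weights vanish, against total mass 1. The
lower bounds then propagate positivity. -/
theorem DimensionDecrease.pos {A₁ A₂ A₃ A₄ : ℝ} (hA₁ : 0 < A₁) (hp : 0 < p) {w : ℕ → ℝ}
    (hw : IsDimensionPMF p w) (hdec : DimensionDecrease A₁ A₂ A₃ A₄ p w) :
    ∀ s ≤ p, 0 < w s := by
  have hp0 : (0 : ℝ) < p := by exact_mod_cast hp
  have h0 : 0 < w 0 := by
    refine lt_of_le_of_ne (hw.1 0 (Nat.zero_le _)) fun h0 => ?_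
    have hall : ∀ s ≤ p, w s = 0 := by
      intro s
      induction s with
      | zero => exact fun _ => h0.symm
      | succ s ih =>
        intro hs
        have h1 := (hdec (s + 1) (by omega) hs).2
        rw [Nat.add_sub_cancel, ih (by omega), mul_zero] at h1
        exact le_antisymm h1 (hw.1 _ hs)
    have h2 := hw.2
    rw [Finset.sum_eq_zero fun s hs => hall s (by rw [Finset.mem_range] at hs; omega)] at h2
    exact zero_ne_one h2
  intro s
  induction s with
  | zero => exact fun _ => h0
  | succ s ih =>
    intro hs
    have h1 := (hdec (s + 1) (by omega) hs).1
    rw [Nat.add_sub_cancel] at h1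
    have h2 := ih (by omega)
    exact lt_of_lt_of_le (by positivity) h1

theorem DimensionDecrease.le_pow_mul {A₁ A₂ A₃ A₄ : ℝ} (hA₂ : 0 < A₂) {w : ℕ → ℝ}
    (hdec : DimensionDecrease A₁ A₂ A₃ A₄ p w) (s : ℕ) :
    ∀ J : ℕ, s + J ≤ p → w (s + J) ≤ (A₂ * (p : ℝ) ^ (-A₄)) ^ J * w s
  | 0, _ => by simp
  | J + 1, h => by
    have h1 := (hdec (s + (J + 1)) (by omega) h).2
    rw [show s + (J + 1) - 1 = s + J by omega] at h1
    have h2 := hdec.le_pow_mul hA₂ s J (by omega)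
    have h3 : 0 ≤ A₂ * (p : ℝ) ^ (-A₄) := by positivity
    calc _ ≤ _ := h1
      _ ≤ A₂ * (p : ℝ) ^ (-A₄) * ((A₂ * (p : ℝ) ^ (-A₄)) ^ J * w s) := by gcongr
      _ = _ := by ring

/-- The number of supersets with `J` extra elements almost cancels the uniform prior within each
dimension: choosing `s + J` elements and then `s` of them is choosing `s` and then `J` more. Only
`(s + J).choose s` survives. -/
theorem choose_mul_weight_ratio_le {B : ℝ} {w : ℕ → ℝ} (hw : ∀ s ≤ p, 0 < w s) {s J : ℕ}
    (hsJ : s + J ≤ p) (hB : w (s + J) ≤ B * w s) :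
    ((p - s).choose J : ℝ) *
      ((w (s + J) / p.choose (s + J)) / (w s / p.choose s)) ≤ B * (s + J).choose s := by
  have h1 : (p.choose (s + J) : ℝ) * (s + J).choose s = p.choose s * (p - s).choose J := by
    have := Nat.choose_mul (n := p) (k := s + J) (s := s) (by omega)
    rw [Nat.add_sub_cancel_left] at this
    exact_mod_cast this
  have h2 : (0 : ℝ) < p.choose (s + J) := by exact_mod_cast Nat.choose_pos hsJ
  have h3 : (0 : ℝ) < p.choose s := by exact_mod_cast Nat.choose_pos (by omega)
  have h4 := hw s (by omega)
  have h5 : ((p - s).choose J : ℝ) * ((w (s + J) / p.choose (s + J)) / (w s / p.choose s)) =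
      w (s + J) / w s * (s + J).choose s := by
    field_simp
    linear_combination (-w (s + J)) * h1
  rw [h5]
  gcongr
  rwa [div_le_iff₀ h4]

/-- The rate at which supersets of a large dimension lose posterior mass. -/
def rateLarge (A₂ A₄ x : ℝ) : ℝ := 128 * A₂ * √(Real.log x) * x ^ (-A₄ / 3)

/-- The rate at which supersets of a small dimension lose posterior mass. -/
def rateSmall (A₂ A₄ a c₀ x : ℝ) : ℝ :=
  √(x * (A₂ * x ^ (-A₄)) * ((2 + 3 / A₄ + 66 / c₀ ^ 2) * x ^ a)) *
    (2 * √(2 * √(Real.log x) * √(12 * Real.pi) / c₀))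

theorem large_term_le {A₂ A₄ x l : ℝ} (hA₂ : 0 < A₂) {w : ℕ → ℝ}
    (hw : ∀ s ≤ p, 0 < w s) (hlog : 1 ≤ Real.log p) {s J : ℕ} (hsJ : s + J ≤ p)
    (hdec : w (s + J) ≤ (A₂ * (p : ℝ) ^ (-A₄)) ^ J * w s)
    (hl : 1 / (2 * p ^ 2 * √(Real.log p)) ≤ l) (hJ : s ≤ J)
    (hxJ : 2 * s + 49 / 4 * s * x ≤ 2 / 3 * A₄ * J) :
    ((p - s).choose J : ℝ) * ((w (s + J) / p.choose (s + J)) / (w s / p.choose s) *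
      (Real.exp 4 / l ^ s * (Real.exp (49 / 4 * s * x * Real.log p) * 4 ^ (s + J)))) ≤
      Real.exp 4 * rateLarge A₂ A₄ p ^ J := by
  have hp0 : (0 : ℝ) < p := by
    rcases Nat.eq_zero_or_pos p with h | h
    · rw [h] at hlog; norm_num at hlog
    · exact_mod_cast h
  set L := Real.log p with hL
  have hL1 : 1 ≤ √L := Real.one_le_sqrt.2 hlog
  have hl0 : 0 < l := lt_of_lt_of_le (by positivity) hl
  have h1 := choose_mul_weight_ratio_le hw hsJ hdec
  have h2 : ((s + J).choose s : ℝ) ≤ 4 ^ J := by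
    have : (s + J).choose s ≤ 4 ^ J := by
      calc (s + J).choose s ≤ 2 ^ (s + J) := Nat.choose_le_two_pow _ _
        _ ≤ 2 ^ (2 * J) := Nat.pow_le_pow_right (by norm_num) (by omega)
        _ = 4 ^ J := by rw [pow_mul]; norm_num
    exact_mod_cast this
  have h3 : (4 : ℝ) ^ (s + J) ≤ 16 ^ J := by
    calc (4 : ℝ) ^ (s + J) ≤ 4 ^ (2 * J) := pow_le_pow_right₀ (by norm_num) (by omega)
      _ = 16 ^ J := by rw [pow_mul]; norm_num
  have h4 : 1 / l ^ s ≤ (2 * √L) ^ J * Real.exp (2 * s * L) := by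
    have h5 : 1 / l ≤ 2 * √L * p ^ 2 := by
      rw [div_le_iff₀ hl0]
      rw [div_le_iff₀ (by positivity)] at hl
      linarith
    calc 1 / l ^ s = (1 / l) ^ s := by rw [div_pow, one_pow]
      _ ≤ (2 * √L * p ^ 2) ^ s := pow_le_pow_left₀ (by positivity) h5 s
      _ = (2 * √L) ^ s * (p ^ 2) ^ s := mul_pow _ _ _
      _ ≤ (2 * √L) ^ J * (p ^ 2) ^ s := by
          gcongr
          linarith
      _ = _ := by
          congr 1
          rw [show 2 * (s : ℝ) * L = L * ((2 * s : ℕ) : ℝ) by push_cast; ring, Real.exp_mul, hL,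
            Real.exp_log hp0, Real.rpow_natCast, pow_mul]
  -- All powers of p lost in the evidence bounds are absorbed by two thirds of the prior decay.
  have h6 : Real.exp (2 * s * L) * Real.exp (49 / 4 * s * x * L) ≤
      ((p : ℝ) ^ (2 / 3 * A₄)) ^ J := by
    rw [← Real.exp_add, ← Real.rpow_natCast, ← Real.rpow_mul hp0.le, Real.rpow_def_of_pos hp0]
    apply Real.exp_le_exp.2
    have := mul_le_mul_of_nonneg_right hxJ (by linarith : 0 ≤ L)
    linarith
  -- The factor 128 is 4 · 2 · 16, from the binomial coefficient, from `1 / l` and from `4 ^ (s +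
  -- J)`.
  have h7 : rateLarge A₂ A₄ p =
      A₂ * (p : ℝ) ^ (-A₄) * 4 * (2 * √L) * (p : ℝ) ^ (2 / 3 * A₄) * 16 := by
    rw [rateLarge, show -A₄ / 3 = -A₄ + 2 / 3 * A₄ by ring, Real.rpow_add hp0]
    ring
  have h8 := h1.trans (mul_le_mul_of_nonneg_left h2 (by positivity))
  obtain ⟨u, hu⟩ : ∃ u : ℝ, u = ((p - s).choose J : ℝ) *
    ((w (s + J) / p.choose (s + J)) / (w s / p.choose s)) := ⟨_, rfl⟩
  rw [← hu] at h8
  rw [h7]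
  calc _ = Real.exp 4 * (u * (1 / l ^ s) *
        Real.exp (49 / 4 * s * x * L) * 4 ^ (s + J)) := by rw [hu]; ring
    _ ≤ Real.exp 4 * ((A₂ * (p : ℝ) ^ (-A₄)) ^ J * 4 ^ J *
        ((2 * √L) ^ J * Real.exp (2 * s * L)) * Real.exp (49 / 4 * s * x * L) * 16 ^ J) := by
        gcongr
    _ = Real.exp 4 * ((A₂ * (p : ℝ) ^ (-A₄)) ^ J * 4 ^ J * (2 * √L) ^ J *
        (Real.exp (2 * s * L) * Real.exp (49 / 4 * s * x * L)) * 16 ^ J) := by ring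
    _ ≤ Real.exp 4 * ((A₂ * (p : ℝ) ^ (-A₄)) ^ J * 4 ^ J * (2 * √L) ^ J *
        ((p : ℝ) ^ (2 / 3 * A₄)) ^ J * 16 ^ J) := by gcongr
    _ = _ := by simp only [mul_pow]

theorem small_term_le {A₂ A₄ a c₀ N lam : ℝ} (hA₂ : 0 < A₂) (hc₀ : 0 < c₀) (hN : 0 < N)
    {w : ℕ → ℝ} (hw : ∀ s ≤ p, 0 < w s) (hlam : 0 < lam)
    (hlamN : lam ≤ 4 * N * √(Real.log p)) {s J : ℕ} (hsJ : s + J ≤ p)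
    (hdec : w (s + J) ≤ (A₂ * (p : ℝ) ^ (-A₄)) ^ J * w s)
    (hcard : ((s + J : ℕ) : ℝ) ≤ (2 + 3 / A₄ + 66 / c₀ ^ 2) * (p : ℝ) ^ a) :
    ((p - s).choose J : ℝ) * (√((w (s + J) / p.choose (s + J)) / (w s / p.choose s)) *
      (Real.exp (3 / 2) * (2 * √(lam / 2 * √(Real.pi / ((c₀ * N) ^ 2 / 12)))) ^ J)) ≤
      Real.exp 4 * rateSmall A₂ A₄ a c₀ p ^ J := by
  set K := (2 + 3 / A₄ + 66 / c₀ ^ 2) * (p : ℝ) ^ a with hK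
  have hK0 : 0 ≤ K := le_trans (Nat.cast_nonneg _) hcard
  set ρ := (w (s + J) / p.choose (s + J)) / (w s / p.choose s) with hρ
  set b := p * (A₂ * (p : ℝ) ^ (-A₄)) * K with hb
  have hb0 : 0 ≤ b := by positivity
  have h1 := choose_mul_weight_ratio_le hw hsJ hdec
  have h2 : ((s + J).choose s : ℝ) ≤ K ^ J := by
    have h3 : (s + J).choose s ≤ (s + J) ^ J := by
      rw [Nat.choose_symm_add]; exact Nat.choose_le_pow _ _
    calc ((s + J).choose s : ℝ) ≤ ((s + J : ℕ) : ℝ) ^ J := by exact_mod_cast h3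
      _ ≤ K ^ J := by gcongr
  have h3 : ((p - s).choose J : ℝ) ≤ (p : ℝ) ^ J := by
    have : (p - s).choose J ≤ p ^ J :=
      (Nat.choose_le_pow _ _).trans (Nat.pow_le_pow_left (Nat.sub_le _ _) J)
    exact_mod_cast this
  -- The square root cancels only half of the number of models. The other half is bounded by
  -- p^(J/2), whence the factor p inside `b`.
  have h4 : ((p - s).choose J : ℝ) * √ρ ≤ √b ^ J := by
    refine le_of_sq_le_sq ?_ (by positivity)
    rw [← pow_mul, mul_comm J, pow_mul, Real.sq_sqrt hb0, mul_pow]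
    have hρ0 : 0 ≤ ρ := div_nonneg (div_nonneg (hw _ hsJ).le (by positivity))
      (div_nonneg (hw s (by omega)).le (by positivity))
    rw [Real.sq_sqrt hρ0]
    calc _ = ((p - s).choose J : ℝ) * (((p - s).choose J : ℝ) * ρ) := by ring
      _ ≤ (p : ℝ) ^ J * ((A₂ * (p : ℝ) ^ (-A₄)) ^ J * K ^ J) := by
          refine mul_le_mul h3 (h1.trans (by gcongr)) ?_ (by positivity)
          exact mul_nonneg (Nat.cast_nonneg _) hρ0
      _ = b ^ J := by rw [hb, mul_pow _ K, mul_pow (p : ℝ), mul_assoc]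
  have h5 : lam / 2 * √(Real.pi / ((c₀ * N) ^ 2 / 12)) ≤
      2 * √(Real.log p) * √(12 * Real.pi) / c₀ := by
    rw [show Real.pi / ((c₀ * N) ^ 2 / 12) = 12 * Real.pi / (c₀ * N) ^ 2 by
      rw [div_div_eq_mul_div, mul_comm], Real.sqrt_div (by positivity),
      Real.sqrt_sq (by positivity)]
    calc lam / 2 * (√(12 * Real.pi) / (c₀ * N)) ≤
        4 * N * √(Real.log p) / 2 * (√(12 * Real.pi) / (c₀ * N)) := by gcongr
      _ = _ := by field_simp; ring
  calc _ = ((p - s).choose J : ℝ) * √ρ * (Real.exp (3 / 2) *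
        (2 * √(lam / 2 * √(Real.pi / ((c₀ * N) ^ 2 / 12)))) ^ J) := by ring
    _ ≤ √b ^ J * (Real.exp 4 *
        (2 * √(2 * √(Real.log p) * √(12 * Real.pi) / c₀)) ^ J) := by
        gcongr
        norm_num
    _ = _ := by rw [rateSmall, mul_pow]; ring

/-- The binomial coefficient cancels the number of sets of each size. What remains is a geometric
series without its constant term, so the sum is of order `q`. -/
theorem sum_powerset_le {ι : Type*} [DecidableEq ι] (U : Finset ι) (h : Finset ι → ℝ≥0∞)
    {C q : ℝ} (hC : 0 ≤ C) (hq : 0 ≤ q) (hq2 : q ≤ 1 / 2)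
    (hh : ∀ T ⊆ U, T ≠ ∅ → h T ≤ ENNReal.ofReal (C * q ^ T.card / U.card.choose T.card)) :
    ∑ T ∈ U.powerset.erase ∅, h T ≤ ENNReal.ofReal (2 * C * q) := by
  let g : ℕ → ℝ≥0∞ := fun J =>
    if J = 0 then 0 else ENNReal.ofReal (C * q ^ J / U.card.choose J)
  have h1 : ∑ T ∈ U.powerset.erase ∅, h T ≤ ∑ T ∈ U.powerset, g T.card := by
    refine (Finset.sum_le_sum (g := fun T => g T.card) fun T hT => ?_).trans
      (Finset.sum_le_sum_of_subset (Finset.erase_subset _ _))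
    rw [Finset.mem_erase, Finset.mem_powerset] at hT
    simpa [g, hT.1] using hh T hT.2 hT.1
  refine h1.trans ?_
  rw [Finset.sum_powerset_apply_card, Finset.sum_range_succ']
  have h2 : ∀ J ∈ Finset.range U.card, U.card.choose (J + 1) • g (J + 1) =
      ENNReal.ofReal (C * q * q ^ J) := by
    intro J hJ
    have hpos : (0 : ℝ) < U.card.choose (J + 1) := by
      exact_mod_cast Nat.choose_pos (by rw [Finset.mem_range] at hJ; omega)
    simp only [g, Nat.succ_ne_zero, if_false]
    rw [nsmul_eq_mul, ← ENNReal.ofReal_natCast, ← ENNReal.ofReal_mul hpos.le]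
    congr 1
    field_simp
    ring
  rw [Finset.sum_congr rfl h2, ← ENNReal.ofReal_sum_of_nonneg fun J _ => by positivity]
  simp only [g, if_true, smul_zero, add_zero]
  apply ENNReal.ofReal_le_ofReal
  rw [← Finset.mul_sum]
  have h3 := mul_geom_sum q U.card
  have h4 : 0 ≤ q ^ U.card := by positivity
  have h5 : 0 ≤ ∑ i ∈ Finset.range U.card, q ^ i := Finset.sum_nonneg fun i _ => by positivity
  have h6 : ∑ i ∈ Finset.range U.card, q ^ i ≤ 2 := by nlinarith
  nlinarith [mul_nonneg hC hq]

/-! ### The nonasymptotic bound -/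

/-- Nonasymptotic bound on the expected posterior mass of the strict supersets of the true
model. -/
theorem lintegral_posterior_ssubset_le {A₁ A₂ A₃ A₄ a c₀ lam : ℝ} (hA₁ : 0 < A₁) (hA₂ : 0 < A₂)
    (hA₄ : 1 < A₄) (hc₀ : 0 < c₀) (hlam : 0 < lam) (X : Matrix (Fin n) (Fin p) ℝ)
    (hlog : 1 ≤ Real.log p) (hX : 0 < colNorm X) (hlam1 : colNorm X / p ≤ lam)
    (hlam2 : lam ≤ 2 * lamBar X) {w : ℕ → ℝ} (hw : IsDimensionPMF p w)
    (hdec : DimensionDecrease A₁ A₂ A₃ A₄ p w)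
    (hq : rateLarge A₂ A₄ p + rateSmall A₂ A₄ a c₀ p ≤ 1 / 2) (β₀ : Fin p → ℝ)
    (hcompat : ENNReal.ofReal c₀ ≤ compat X (support β₀))
    (hcard : ((support β₀).card : ℝ) ≤ (p : ℝ) ^ a)
    (hpsi : ENNReal.ofReal c₀ ≤ psiTilde X lam A₄ (support β₀))
    (hκ : lam * (support β₀).card ≤ c₀ * colNorm X) :
    ∫⁻ y, posterior X w lam y {β | support β₀ ⊂ support β} ∂(dataLaw X β₀) ≤
      ENNReal.ofReal (2 / p) + ENNReal.ofReal
        (2 * Real.exp 4 * (rateLarge A₂ A₄ p + rateSmall A₂ A₄ a c₀ p)) := by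
  classical
  have hp : 1 < p := by
    by_contra! h
    have : Real.log p ≤ 0 := Real.log_nonpos (by positivity) (by exact_mod_cast h)
    linarith
  have hp0 : (0 : ℝ) < p := by exact_mod_cast (by omega : 0 < p)
  have hwpos := hdec.pos hA₁ (by omega) hw
  have hL : 0 < √(Real.log p) := Real.sqrt_pos.2 (by linarith)
  have hlb : 0 < lamBar X := by unfold lamBar; positivity
  obtain ⟨f, hf, hcf, hfX, hSV⟩ :=
    exists_compat_constant hlam (by linarith) hc₀ X hX _ hcompat hpsi
  have hβ₀ := eq_zero_of_notMem_support β₀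
  set S₀ := support β₀ with hS₀
  have hS₀p : S₀.card ≤ p := by simpa using S₀.card_le_univ
  set x := lam / lamBar X / f ^ 2 with hx
  have hx0 : 0 ≤ x := by positivity
  have hrl : 0 ≤ rateLarge A₂ A₄ p := by unfold rateLarge; positivity
  have hrs : 0 ≤ rateSmall A₂ A₄ a c₀ p := by unfold rateSmall; positivity
  refine (lintegral_posterior_le hlam X w β₀
    -- Below this threshold |S₀ ∪ T| is at most the dimension in `psiTilde`, whose constant is 2
    -- instead of 1 because it also counts `S₀`.
    (fun J => (1 + 3 / A₄ + 33 * x) * S₀.card < J)).trans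
    (add_le_add (dataLaw_noiseEvent_compl_le hp X hX β₀) ?_)
  refine sum_powerset_le _ _ (Real.exp_pos 4).le (add_nonneg hrl hrs) hq fun T hT hT0 => ?_
  have hdisj : Disjoint S₀ T :=
    Finset.disjoint_left.2 fun i hi hiT => Finset.mem_compl.1 (hT hiT) hi
  have hTcard : (S₀ ∪ T).card = S₀.card + T.card := Finset.card_union_of_disjoint hdisj
  have hsJ : S₀.card + T.card ≤ p := by
    rw [← hTcard]; simpa using (S₀ ∪ T).card_le_univ
  have hU : S₀ᶜ.card = p - S₀.card := by rw [Finset.card_compl, Fintype.card_fin]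
  have hchoose : (0 : ℝ) < (p - S₀.card).choose T.card := by
    exact_mod_cast Nat.choose_pos (by omega)
  have hratio := hdec.le_pow_mul hA₂ S₀.card T.card hsJ
  rw [hU]
  split_ifs with hP
  -- With this half-width the box condition reads |S₀| ≤ p, and `colNorm X / p ≤ lam` gives λr ≥
  -- 1/(2p²√log p).
  · have hr : 0 < 1 / (p * lamBar X) := by positivity
    refine (setLIntegral_modelOdds_le hlam X hwpos hlog hX hlam2 S₀ (S₀ ∪ T) β₀ hβ₀ hf hfX hr
      ?_).trans (ENNReal.ofReal_le_ofReal ?_)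
    · have : (S₀.card : ℝ) ≤ p := by exact_mod_cast hS₀p
      rw [mul_assoc, show 1 / (p * lamBar X) * lamBar X = 1 / p by field_simp, mul_one_div,
        div_le_one hp0]
      exact this
    rw [le_div_iff₀ hchoose, mul_comm, hTcard]
    refine (large_term_le (A₂ := A₂) (A₄ := A₄) hA₂ hwpos hlog hsJ hratio ?_ ?_ ?_).trans ?_
    · rw [div_le_iff₀ (by positivity), lamBar]
      rw [div_le_iff₀ hp0] at hlam1
      have : lam * (1 / (p * (2 * colNorm X * √(Real.log p)))) * (2 * p ^ 2 * √(Real.log p)) =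
          lam * p / colNorm X := by field_simp
      rw [this, le_div_iff₀ hX]
      linarith
    · have h1 : (S₀.card : ℝ) < T.card := by
        refine lt_of_le_of_lt ?_ hP
        have : 0 ≤ 3 / A₄ := by positivity
        exact le_mul_of_one_le_left (by positivity) (by linarith)
      exact_mod_cast h1.le
    -- Two thirds of A₄ times the threshold is at least 2s + 22xs, since A₄ > 1; and 22 exceeds
    -- 49/4.
    · have h1 : A₄ * ((1 + 3 / A₄ + 33 * x) * S₀.card) ≤ A₄ * T.card :=
        mul_le_mul_of_nonneg_left hP.le (by linarith)
      have h2 : A₄ * ((1 + 3 / A₄ + 33 * x) * S₀.card) =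
          A₄ * S₀.card + 3 * S₀.card + 33 * (A₄ * (x * S₀.card)) := by
        field_simp
      have h3 : x * S₀.card ≤ A₄ * (x * S₀.card) :=
        le_mul_of_one_le_left (by positivity) hA₄.le
      have h4 : 0 ≤ x * S₀.card := by positivity
      have h5 : 0 ≤ A₄ * S₀.card := by positivity
      nlinarith
    · gcongr
      linarith
  · have hP' : (T.card : ℝ) ≤ (1 + 3 / A₄ + 33 * x) * S₀.card := not_lt.1 hP
    -- For empty `S₀` every nonempty `T` counts as large, so here the true model is nonempty and `c₀
    -- ≤ f` is available.
    have hs0 : S₀.card ≠ 0 := by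
      intro h0
      rw [h0, Nat.cast_zero, mul_zero] at hP'
      have : T.card = 0 := by exact_mod_cast le_antisymm hP' (Nat.cast_nonneg _)
      exact hT0 (Finset.card_eq_zero.1 this)
    have hs1 : (1 : ℝ) ≤ S₀.card := by exact_mod_cast Nat.one_le_iff_ne_zero.2 hs0
    have hsum : ((S₀.card + T.card : ℕ) : ℝ) ≤ (2 + 3 / A₄ + 33 * x) * S₀.card := by
      push_cast; linarith
    refine (lintegral_sqrt_modelOdds_le (c := c₀ * colNorm X) hlam X hwpos (by positivity) S₀ T
      hdisj β₀ hβ₀ (fun v hv => hSV v ?_) ?_).trans (ENNReal.ofReal_le_ofReal ?_)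
    · refine le_trans ?_ hsum
      rw [← hTcard]
      have : support v ⊆ S₀ ∪ T := fun i hi => by
        by_contra h
        exact mem_support.1 hi (hv i h)
      exact_mod_cast Finset.card_le_card this
    · refine le_trans ?_ hκ
      gcongr
      exact Real.sqrt_le_iff.2 ⟨by positivity, by nlinarith⟩
    rw [le_div_iff₀ hchoose, mul_comm, hTcard]
    refine (small_term_le (a := a) hA₂ hc₀ hX hwpos hlam ?_ hsJ hratio ?_).trans ?_
    · rw [lamBar] at hlam2; linarith
    -- Since λ ≤ 2λ̄; this turns 33x into the 66/c₀² of `rateSmall`.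
    · have hx2 : x ≤ 2 / c₀ ^ 2 := by
        rw [hx]
        have : lam / lamBar X ≤ 2 := by rw [div_le_iff₀ hlb]; exact hlam2
        exact div_le_div₀ (by norm_num) this (by positivity)
          (pow_le_pow_left₀ hc₀.le (hcf hs0) 2)
      refine hsum.trans ?_
      have h66 : 66 / c₀ ^ 2 = 33 * (2 / c₀ ^ 2) := by ring
      rw [h66]
      have : 0 ≤ 3 / A₄ := by positivity
      gcongr
    · gcongr
      linarith

/-! ### The rates tend to zero -/

theorem tendsto_sqrt_log_mul_rpow_neg {d : ℝ} (hd : 0 < d) :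
    Tendsto (fun x : ℝ => √(Real.log x) * x ^ (-d)) atTop (𝓝 0) := by
  have h := (isLittleO_log_rpow_rpow_atTop (1 / 2) hd).tendsto_div_nhds_zero
  refine h.congr' ?_
  filter_upwards [eventually_ge_atTop 0] with x hx
  rw [Real.sqrt_eq_rpow, Real.rpow_neg hx, div_eq_mul_inv]

theorem tendsto_rateLarge {A₂ A₄ : ℝ} (hA₄ : 0 < A₄) :
    Tendsto (rateLarge A₂ A₄) atTop (𝓝 0) := by
  have h := (tendsto_sqrt_log_mul_rpow_neg (by positivity : 0 < A₄ / 3)).const_mul (128 * A₂)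
  rw [mul_zero] at h
  refine h.congr fun x => ?_
  rw [rateLarge, neg_div]
  ring

/-- Under one square root the rate is a constant times √(log x) · x^(-(A₄ - 1 - a)), with a negative
exponent precisely because a < A₄ - 1. -/
theorem tendsto_rateSmall {A₂ A₄ a c₀ : ℝ} (hA₂ : 0 < A₂) (hA₄ : 0 < A₄) (ha : a < A₄ - 1)
    (hc₀ : 0 < c₀) : Tendsto (rateSmall A₂ A₄ a c₀) atTop (𝓝 0) := by
  have h := ((tendsto_sqrt_log_mul_rpow_neg (by linarith : 0 < A₄ - 1 - a)).const_mul
    (A₂ * (2 + 3 / A₄ + 66 / c₀ ^ 2) * (2 * √(12 * Real.pi) / c₀))).sqrt.const_mul 2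
  rw [mul_zero, Real.sqrt_zero, mul_zero] at h
  refine h.congr' ?_
  filter_upwards [eventually_gt_atTop 0] with x hx
  rw [rateSmall, mul_left_comm (√(x * _ * _)) 2, ← Real.sqrt_mul (by positivity)]
  congr 2
  rw [show -(A₄ - 1 - a) = 1 + -A₄ + a by ring, Real.rpow_add hx, Real.rpow_add hx,
    Real.rpow_one]
  ring

end SparseRegression

end

open SparseRegression in
theorem theorem4
    (n p : ℕ → ℕ) (hp : Tendsto p atTop atTop)
    (X : ∀ k, Matrix (Fin (n k)) (Fin (p k)) ℝ)
    (lam : ℕ → ℝ) (hlam_pos : ∀ k, 0 < lam k)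
    (hlam : ∀ k, colNorm (X k) / p k ≤ lam k ∧ lam k ≤ 2 * lamBar (X k))
    (w : ℕ → ℕ → ℝ) (hw : ∀ k, IsDimensionPMF (p k) (w k))
    (A₁ A₂ A₃ A₄ : ℝ) (hA₁ : 0 < A₁) (hA₂ : 0 < A₂) (hA₃ : 0 < A₃) (hA₄ : 1 < A₄)
    (hdec : ∀ k, DimensionDecrease A₁ A₂ A₃ A₄ (p k) (w k))
    (c₀ : ℝ) (hc₀ : 0 < c₀)
    (a : ℝ) (ha : a < A₄ - 1)
    (s : ℕ → ℝ) (hs : ∀ k, s k ≤ (p k : ℝ) ^ a)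
    (hs_lam : Tendsto (fun k => s k * lam k * √(Real.log (p k)) / colNorm (X k)) atTop (𝓝 0)) :
    Tendsto
      (fun k => ⨆ β₀ ∈ {β : Fin (p k) → ℝ |
          ENNReal.ofReal c₀ ≤ compat (X k) (support β) ∧
          ((support β).card : ℝ) ≤ s k ∧
          ENNReal.ofReal c₀ ≤ psiTilde (X k) (lam k) A₄ (support β)},
        ∫⁻ y, posterior (X k) (w k) (lam k) y {β | support β₀ ⊂ support β}
          ∂(dataLaw (X k) β₀))
      atTop (𝓝 0) := by
  have hpR : Tendsto (fun k => (p k : ℝ)) atTop atTop := tendsto_natCast_atTop_atTop.comp hp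
  have hrate : Tendsto (fun k => rateLarge A₂ A₄ (p k) + rateSmall A₂ A₄ a c₀ (p k)) atTop
      (𝓝 0) := by
    have h := ((tendsto_rateLarge (A₂ := A₂) (by linarith : 0 < A₄)).add
      (tendsto_rateSmall hA₂ (by linarith) ha hc₀)).comp hpR
    rwa [add_zero] at h
  have hbound : Tendsto (fun k => ENNReal.ofReal (2 / p k) + ENNReal.ofReal
      (2 * Real.exp 4 * (rateLarge A₂ A₄ (p k) + rateSmall A₂ A₄ a c₀ (p k)))) atTop (𝓝 0) := by
    have h1 := ENNReal.tendsto_ofReal (tendsto_const_nhds (x := (2 : ℝ)) |>.div_atTop hpR)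
    have h2 := ENNReal.tendsto_ofReal (hrate.const_mul (2 * Real.exp 4))
    simpa using h1.add h2
  refine tendsto_of_tendsto_of_tendsto_of_le_of_le' tendsto_const_nhds hbound
    (Eventually.of_forall fun _ => bot_le) ?_
  filter_upwards [(Real.tendsto_log_atTop.comp hpR).eventually_ge_atTop 1,
    hrate.eventually_le_const (by norm_num : (0 : ℝ) < 1 / 2),
    hs_lam.eventually_le_const hc₀] with k hlog hq hsl
  refine iSup₂_le fun β₀ hβ₀ => ?_
  obtain ⟨hcompat, hcard, hpsi⟩ := hβ₀
  simp only [Function.comp_apply] at hlog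
  -- A zero design would give λ̄ = 0, against 0 < λ ≤ 2λ̄.
  have hX : 0 < colNorm (X k) := by
    refine lt_of_le_of_ne (colNorm_nonneg _) fun h0 => ?_
    have h1 := (hlam k).2
    rw [lamBar, ← h0] at h1
    have h2 := hlam_pos k
    linarith
  refine lintegral_posterior_ssubset_le hA₁ hA₂ hA₄ hc₀ (hlam_pos k) (X k) hlog hX (hlam k).1
    (hlam k).2 (hw k) (hdec k) hq β₀ hcompat (hcard.trans (hs k)) hpsi ?_
  rw [div_le_iff₀ hX] at hsl
  refine le_trans ?_ hsl
  have hL : 1 ≤ √(Real.log (p k)) := Real.one_le_sqrt.2 hlog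
  -- The sequence may take negative values, but then the supremum is over the empty set; a given
  -- `β₀` forces nonnegativity.
  have h0 : 0 ≤ s k := le_trans (Nat.cast_nonneg _) hcard
  calc lam k * (support β₀).card ≤ lam k * s k :=
        mul_le_mul_of_nonneg_left hcard (hlam_pos k).le
    _ = s k * lam k := mul_comm _ _
    _ ≤ s k * lam k * √(Real.log (p k)) :=
        le_mul_of_one_le_right (mul_nonneg h0 (hlam_pos k).le) hL
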